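/- Let $k$ be a field, $E$ a finite set, and let $A$ be a non-commutative duplicate of $E$: a twisted tensor product of $k^E$ and $k^{\{a,b\}}=k[X]/(X^2-X)$, i.e. a $k$-algebra with algebra maps $k^E\to A$ and $k^{\{a,b\}}\to A$ such that $u\otimes v\mapsto uv$ is a linear isomorphism $k^E\otimes k^{\{a,b\}}\to A$. Then $Xb=\delta(b)+f(b)X$ for $b\in k^E$, where $f(b)=b\circ\varphi$ is the algebra endomorphism of $k^E$ given by a set map $\varphi:E\to E$, and $\delta(b)=(f(b)-b)\,a$ for a unique $a\in k^E$ with $a_x=0$ whenever $\varphi(x)=x$. Let $Q_\varphi$ be the quiver with vertex set $E$ and one arrow $x\to\varphi(x)$ for each $x\in E$. Let $Q$ be the related quiver: its vertices are the $x\in E$ with $\varphi(x)\ne x$, together with two vertices $\ell_0,\ell_{-1}$ for every $\ell\in E$ with $\varphi(\ell)=\ell$; for each $x$ with $\varphi(x)\neq x$ it has one arrow ending at $x$, which starts at $\varphi(x)$ if $\varphi(x)$ is not a fixed point of $\varphi$, and at $\ell_{\varepsilon}$ with $\varepsilon=a_x\in\{0,-1\}$ if $\varphi(x)=\ell$ is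 a fixed point. Call a connected quiver one-sink-one-valued if it has exactly one sink (a vertex that is the source of no arrow) and every other vertex is the source of exactly one arrow. Then the opposite quiver $Q^{\mathrm{op}}$ is a disjoint union of connected one-sink-one-valued quivers if and only if every proper oriented cycle of $Q_\varphi$ (one that is not an iteration of a shorter oriented cycle) is a loop. If these equivalent conditions hold, then the Hochschild cohomology $HH^n(A)=H^n(A,A)$ satisfies: 1. $HH^n(A)=0$ for all $n\ge 2$; 2. $\dim_k HH^0(A)$ is the number of connected components of $Q$; 3. $\dim_k HH^1(A)$ is the Euler characteristic of the underlying graph of $Q$, normalized as $|Q_1|-|Q_0|+1$ for a connected quiver and added over connected components, i.e. $|Q_1|-|Q_0|+c$, where $|Q_0|$, $|Q_1|$ and $c$ are the numbers of vertices, arrows and connected components of $Q$. -/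

import Mathlib

open scoped TensorProduct

/-! ### Hochschild cohomology -/

section Hochschild

variable (k A : Type*) [CommRing k] [Ring A] [Algebra k A]

/-- Hochschild `n`-cochains of `A` with coefficients in `A`: the `k`-multilinear maps
`A × ⋯ × A → A` (`n` arguments), i.e. `Hom_k (A^{⊗ n}, A)`. -/
abbrev HochschildCochain (n : ℕ) : Type _ := MultilinearMap k (fun _ : Fin n => A) A

variable {k A}

/-- Multiplying two neighbouring entries of a tuple is, as a function of each single entry,
the insertion of a linear expression of that entry at one place. -/
theorem exists_contractNth_update {n : ℕ} (i : Fin n) (m : Fin (n + 1) → A) (p : Fin (n + 1)) :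
    ∃ (j : Fin n) (L : A →ₗ[k] A), ∀ x : A,
      Fin.contractNth i.castSucc (· * ·) (Function.update m p x) =
        Function.update (Fin.contractNth i.castSucc (· * ·) m) j (L x) := by
  rcases lt_trichotomy (p : ℕ) (i : ℕ) with h | h | h
  · refine ⟨⟨p, by omega⟩, LinearMap.id, fun x => ?_⟩
    ext q
    simp only [Fin.contractNth, Function.update_apply, Fin.ext_iff, Fin.val_castSucc, Fin.val_succ,
      LinearMap.id_coe, id_eq]
    split_ifs <;> first | rfl | omega
  · refine ⟨i, LinearMap.mulRight k (m i.succ), fun x => ?_⟩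
    ext q
    simp only [Fin.contractNth, Function.update_apply, Fin.ext_iff, Fin.val_castSucc, Fin.val_succ,
      LinearMap.mulRight_apply]
    split_ifs with h1 h2 h3 h4 h5 h6 h7 h8 <;> first | rfl | omega | skip
    all_goals
      have : q = i := Fin.ext (by omega)
      subst this
      rfl
  · by_cases h' : (p : ℕ) = i + 1
    · refine ⟨i, LinearMap.mulLeft k (m i.castSucc), fun x => ?_⟩
      ext q
      simp only [Fin.contractNth, Function.update_apply, Fin.ext_iff, Fin.val_castSucc,
        Fin.val_succ, LinearMap.mulLeft_apply]
      split_ifs with h1 h2 h3 h4 h5 h6 h7 h8 <;> first | rfl | omega | skip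
      all_goals
        have : q = i := Fin.ext (by omega)
        subst this
        rfl
    · refine ⟨⟨p - 1, by omega⟩, LinearMap.id, fun x => ?_⟩
      ext q
      simp only [Fin.contractNth, Function.update_apply, Fin.ext_iff, Fin.val_castSucc,
        Fin.val_succ, LinearMap.id_coe, id_eq]
      split_ifs <;> first | rfl | omega

/-- The cochain `(a₀, …, aₙ) ↦ a₀ * g (a₁, …, aₙ)`. -/
def HochschildCochain.leftTerm {n : ℕ} (g : HochschildCochain k A n) :
    HochschildCochain k A (n + 1) where
  toFun m := m 0 * g (fun j => m j.succ)
  map_update_add' := by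
    intro inst m p x y
    obtain rfl : inst = instDecidableEqFin (n + 1) := Subsingleton.elim _ _
    refine Fin.cases ?_ (fun q => ?_) p
    · simp [add_mul]
    · have key : ∀ z : A, (fun j : Fin n => Function.update m q.succ z j.succ) =
          Function.update (fun j : Fin n => m j.succ) q z := by
        intro z; ext j; simp [Function.update_apply]
      have h0 : ∀ z : A, Function.update m q.succ z 0 = m 0 := fun z =>
        Function.update_of_ne (Fin.succ_ne_zero q).symm _ _
      simp only [key, h0, MultilinearMap.map_update_add, mul_add]
  map_update_smul' := by
    intro inst m p c x
    obtain rfl : inst = instDecidableEqFin (n + 1) := Subsingleton.elim _ _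
    refine Fin.cases ?_ (fun q => ?_) p
    · simp
    · have key : ∀ z : A, (fun j : Fin n => Function.update m q.succ z j.succ) =
          Function.update (fun j : Fin n => m j.succ) q z := by
        intro z; ext j; simp [Function.update_apply]
      have h0 : ∀ z : A, Function.update m q.succ z 0 = m 0 := fun z =>
        Function.update_of_ne (Fin.succ_ne_zero q).symm _ _
      simp only [key, h0, MultilinearMap.map_update_smul, mul_smul_comm]

/-- The cochain `(a₀, …, aₙ) ↦ g (a₀, …, aᵢ * aᵢ₊₁, …, aₙ)`. -/
def HochschildCochain.middleTerm {n : ℕ} (i : Fin n) (g : HochschildCochain k A n) :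
    HochschildCochain k A (n + 1) where
  toFun m := g (Fin.contractNth i.castSucc (· * ·) m)
  map_update_add' := by
    intro inst m p x y
    obtain rfl : inst = instDecidableEqFin (n + 1) := Subsingleton.elim _ _
    obtain ⟨j, L, h⟩ := exists_contractNth_update (k := k) i m p
    simp only [h, map_add, MultilinearMap.map_update_add]
  map_update_smul' := by
    intro inst m p c x
    obtain rfl : inst = instDecidableEqFin (n + 1) := Subsingleton.elim _ _
    obtain ⟨j, L, h⟩ := exists_contractNth_update (k := k) i m p
    simp only [h, map_smul, MultilinearMap.map_update_smul]

/-- The cochain `(a₀, …, aₙ) ↦ g (a₀, …, aₙ₋₁) * aₙ`. -/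
def HochschildCochain.rightTerm {n : ℕ} (g : HochschildCochain k A n) :
    HochschildCochain k A (n + 1) where
  toFun m := g (fun j => m j.castSucc) * m (Fin.last n)
  map_update_add' := by
    intro inst m p x y
    obtain rfl : inst = instDecidableEqFin (n + 1) := Subsingleton.elim _ _
    refine Fin.lastCases ?_ (fun q => ?_) p
    · have key : ∀ z : A, (fun j : Fin n => Function.update m (Fin.last n) z j.castSucc) =
          (fun j : Fin n => m j.castSucc) := by
        intro z; ext j
        exact Function.update_of_ne (Fin.castSucc_lt_last j).ne _ _
      simp only [key, Function.update_self, mul_add]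
    · have key : ∀ z : A, (fun j : Fin n => Function.update m q.castSucc z j.castSucc) =
          Function.update (fun j : Fin n => m j.castSucc) q z := by
        intro z; ext j; simp [Function.update_apply]
      have h0 : ∀ z : A, Function.update m q.castSucc z (Fin.last n) = m (Fin.last n) := fun z =>
        Function.update_of_ne (Fin.castSucc_lt_last q).ne' _ _
      simp only [key, h0, MultilinearMap.map_update_add, add_mul]
  map_update_smul' := by
    intro inst m p c x
    obtain rfl : inst = instDecidableEqFin (n + 1) := Subsingleton.elim _ _
    refine Fin.lastCases ?_ (fun q => ?_) p
    · have key : ∀ z : A, (fun j : Fin n => Function.update m (Fin.last n) z j.castSucc) =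
          (fun j : Fin n => m j.castSucc) := by
        intro z; ext j
        exact Function.update_of_ne (Fin.castSucc_lt_last j).ne _ _
      simp only [key, Function.update_self, mul_smul_comm]
    · have key : ∀ z : A, (fun j : Fin n => Function.update m q.castSucc z j.castSucc) =
          Function.update (fun j : Fin n => m j.castSucc) q z := by
        intro z; ext j; simp [Function.update_apply]
      have h0 : ∀ z : A, Function.update m q.castSucc z (Fin.last n) = m (Fin.last n) := fun z =>
        Function.update_of_ne (Fin.castSucc_lt_last q).ne' _ _
      simp only [key, h0, MultilinearMap.map_update_smul, smul_mul_assoc]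

variable (k A)

/-- The Hochschild differential
`(d g)(a₀, …, aₙ) = a₀ g(a₁, …, aₙ) + ∑_{i < n} (-1)^{i+1} g(…, aᵢ aᵢ₊₁, …)
  + (-1)^{n+1} g(a₀, …, aₙ₋₁) aₙ`. -/
def hochschildD (n : ℕ) : HochschildCochain k A n →ₗ[k] HochschildCochain k A (n + 1) where
  toFun g := g.leftTerm + ∑ i : Fin n, (-1 : k) ^ ((i : ℕ) + 1) • g.middleTerm i
    + (-1 : k) ^ (n + 1) • g.rightTerm
  map_add' g h := by
    ext m
    simp only [HochschildCochain.leftTerm, HochschildCochain.middleTerm,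
      HochschildCochain.rightTerm, add_apply, sum_apply,
      smul_apply, MultilinearMap.coe_mk, mul_add, add_mul, smul_add,
      Finset.sum_add_distrib]
    abel
  map_smul' c g := by
    ext m
    simp only [HochschildCochain.leftTerm, HochschildCochain.middleTerm,
      HochschildCochain.rightTerm, add_apply, sum_apply,
      smul_apply, MultilinearMap.coe_mk, mul_smul_comm, smul_mul_assoc, smul_add,
      Finset.smul_sum, RingHom.id_apply]
    congr 1
    · congr 1
      exact Finset.sum_congr rfl fun i _ => smul_comm _ _ _
    · exact smul_comm _ _ _

/-- Hochschild coboundaries. -/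
def hochschildB : (n : ℕ) → Submodule k (HochschildCochain k A n)
  | 0 => ⊥
  | n + 1 => LinearMap.range (hochschildD k A n)

set_option maxSynthPendingDepth 5 in
/-- The Hochschild cohomology `HH^n(A) = H^n(A, A)`: cocycles modulo coboundaries. -/
def HochschildCohomology (n : ℕ) : Type _ :=
  LinearMap.ker (hochschildD k A n) ⧸
    (hochschildB k A n).submoduleOf (LinearMap.ker (hochschildD k A n))

set_option maxSynthPendingDepth 5 in
instance (n : ℕ) : AddCommGroup (HochschildCohomology k A n) :=
  inferInstanceAs (AddCommGroup (LinearMap.ker (hochschildD k A n) ⧸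
    (hochschildB k A n).submoduleOf (LinearMap.ker (hochschildD k A n))))

set_option maxSynthPendingDepth 5 in
instance (n : ℕ) : Module k (HochschildCohomology k A n) :=
  inferInstanceAs (Module k (LinearMap.ker (hochschildD k A n) ⧸
    (hochschildB k A n).submoduleOf (LinearMap.ker (hochschildD k A n))))

end Hochschild

/-! ### Quivers -/

section Quivers

/-- The `m`-fold iteration of an oriented cycle. -/
def Quiver.Path.iterate {V : Type*} [Quiver V] {x : V} (p : Quiver.Path x x) :
    ℕ → Quiver.Path x x
  | 0 => Quiver.Path.nil
  | m + 1 => (p.iterate m).comp p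

/-- An oriented cycle (a closed path with at least one arrow) is proper if it is not the iteration
of an oriented cycle of strictly smaller length. -/
def Quiver.Path.IsProperCycle {V : Type*} [Quiver V] {x : V} (p : Quiver.Path x x) : Prop :=
  0 < p.length ∧ ∀ (q : Quiver.Path x x) (m : ℕ), 0 < q.length → q.length < p.length →
    p ≠ q.iterate m

/-- The quiver has no oriented cycles other than loops (and their iterations): every proper
oriented cycle has length one. -/
def HasOnlyLoopCycles (V : Type*) [Quiver V] : Prop :=
  ∀ (x : V) (p : Quiver.Path x x), p.IsProperCycle → p.length = 1

/-- A sink is a vertex that is the source of no arrow. -/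
def IsSinkVertex {V : Type*} [Quiver V] (v : V) : Prop :=
  ∀ w : V, IsEmpty (v ⟶ w)

/-- A one-valued vertex is a vertex that is the source of exactly one arrow. -/
def IsOneValuedVertex {V : Type*} [Quiver V] (v : V) : Prop :=
  Nonempty (Unique (Σ w : V, v ⟶ w))

/-- Every connected component is one-sink-one-valued: it has precisely one sink, and all its other
vertices are one-valued. -/
def IsUnionOneSinkOneValued (V : Type*) [Quiver V] : Prop :=
  ∀ c : Quiver.WeaklyConnectedComponent V,
    (∃! v : V, (v : Quiver.WeaklyConnectedComponent V) = c ∧ IsSinkVertex v) ∧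
    ∀ v : V, (v : Quiver.WeaklyConnectedComponent V) = c → ¬ IsSinkVertex v → IsOneValuedVertex v

/-- The number of connected components of a quiver. -/
noncomputable def numComponents (V : Type*) [Quiver V] : ℕ :=
  Nat.card (Quiver.WeaklyConnectedComponent V)

/-- The Euler characteristic of the underlying graph of a finite quiver, in the normalization used
for Hochschild cohomology of quiver algebras: `|Q₁| - |Q₀| + 1` for a connected quiver, summed over
the connected components, i.e. `|Q₁| - |Q₀| + c`. -/
noncomputable def graphEulerCharacteristic (V : Type*) [Quiver V] : ℤ :=
  (Nat.card (Quiver.Total V) : ℤ) - (Nat.card V : ℤ) + (numComponents V : ℤ)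

/-- The vertex set of the quiver of a set map `φ : E → E`. -/
def MapQuiver {E : Type*} (_φ : E → E) : Type _ := E

/-- The quiver of `φ : E → E` has exactly one arrow `x ⟶ φ x` for every `x`. -/
instance {E : Type*} (φ : E → E) : Quiver (MapQuiver φ) where
  Hom x y := PLift (φ x = y)

/-- The vertices of the quiver related to a map `φ : E → E` and `a : E → k`: the non-loop vertices
of the quiver of `φ`, and two vertices `ℓ_ε`, `ε ∈ {0, -1}`, for every loop vertex `ℓ`. -/
inductive RelatedQuiver {k E : Type*} [Ring k] (φ : E → E) (a : E → k) : Type _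
  | vertex (x : E) (hx : φ x ≠ x) : RelatedQuiver φ a
  | loopVertex (l : E) (hl : φ l = l) (ε : k) (hε : ε = 0 ∨ ε = -1) : RelatedQuiver φ a

/-- The arrows of the related quiver: every arrow `x ⟶ φ x` of the quiver of `φ` that is not a loop
is reversed; if `φ x = ℓ` is a loop vertex, the reversed arrow starts at `ℓ_ε` with `ε = a x`. -/
def RelatedQuiver.IsArrow {k E : Type*} [Ring k] {φ : E → E} {a : E → k} :
    RelatedQuiver φ a → RelatedQuiver φ a → Prop
  | .vertex y _, .vertex x _ => φ x = y
  | .loopVertex l _ ε _, .vertex x _ => φ x = l ∧ a x = ε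
  | _, .loopVertex _ _ _ _ => False

instance {k E : Type*} [Ring k] (φ : E → E) (a : E → k) : Quiver (RelatedQuiver φ a) where
  Hom v w := PLift (RelatedQuiver.IsArrow v w)

end Quivers

/-! ### Twisted tensor products and 2-interlacings -/

/-- A `k`-algebra `Λ` is a twisted tensor product of `A` and `B`: there are algebra maps
`A → Λ` and `B → Λ` such that `a ⊗ b ↦ a * b` is a linear isomorphism `A ⊗ B → Λ`. In other words,
`Λ` is a `k`-algebra structure on the vector space `A ⊗ B` such that `a ↦ a ⊗ 1` and `b ↦ 1 ⊗ b`
are algebra maps and `(a ⊗ 1) (1 ⊗ b) = a ⊗ b`. -/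
structure TwistedTensorProduct (k A B Λ : Type*) [CommRing k] [Ring A] [Algebra k A]
    [Ring B] [Algebra k B] [Ring Λ] [Algebra k Λ] where
  inclA : A →ₐ[k] Λ
  inclB : B →ₐ[k] Λ
  bijective : Function.Bijective
    (LinearMap.mul' k Λ ∘ₗ TensorProduct.map inclA.toLinearMap inclB.toLinearMap)

/-- The set of pairs `(f, δ)` where `f` is an algebra endomorphism of `A` and `δ : A → ᶠA` is an
idempotent derivation with `f = f² + δ f + f δ`. -/
structure TwoInterlacing (k A : Type*) [CommRing k] [Ring A] [Algebra k A] where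
  f : A →ₐ[k] A
  δ : A →ₗ[k] A
  leibniz : ∀ b c : A, δ (b * c) = f b * δ c + δ b * c
  idem : ∀ b : A, δ (δ b) = δ b
  rel : ∀ b : A, f b = f (f b) + δ (f b) + f (δ b)

namespace TwistedTensorProduct

variable {k A Λ : Type*} [Field k] [Ring A] [Algebra k A] [Ring Λ] [Algebra k Λ]

/-- The idempotent `X` of `Λ`, the image of the first of the two points of the set whose algebra is
`Bool → k = k[X]/(X² - X)`. -/
noncomputable def X (D : TwistedTensorProduct k A (Bool → k) Λ) : Λ :=
  D.inclB (Pi.single true 1)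

/-- The linear isomorphism `(Bool → A) ≃ A ⊗ k^{a,b} ≃ Λ`. -/
noncomputable def equiv (D : TwistedTensorProduct k A (Bool → k) Λ) : (Bool → A) ≃ₗ[k] Λ :=
  (TensorProduct.piScalarRight k k A Bool).symm ≪≫ₗ LinearEquiv.ofBijective _ D.bijective

theorem one_eq (D : TwistedTensorProduct k A (Bool → k) Λ) :
    D.inclB (Pi.single false 1) = 1 - D.X := by
  rw [eq_sub_iff_add_eq, X, ← map_add, ← map_one D.inclB]
  congr 1
  ext b
  cases b <;> simp

theorem X_mul_X (D : TwistedTensorProduct k A (Bool → k) Λ) : D.X * D.X = D.X := by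
  rw [X, ← map_mul]
  congr 1
  ext b
  cases b <;> simp

theorem equiv_apply (D : TwistedTensorProduct k A (Bool → k) Λ) (m : Bool → A) :
    D.equiv m = D.inclA (m false) + D.inclA (m true - m false) * D.X := by
  have h : (TensorProduct.piScalarRight k k A Bool).symm m =
      m true ⊗ₜ[k] Pi.single true (1 : k) + m false ⊗ₜ[k] Pi.single false (1 : k) := by
    rw [LinearEquiv.symm_apply_eq]
    ext b
    cases b <;> simp
  rw [equiv, LinearEquiv.trans_apply, h]
  simp only [LinearEquiv.ofBijective_apply, map_add, LinearMap.comp_apply, TensorProduct.map_tmul,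
    LinearMap.mul'_apply, AlgHom.toLinearMap_apply, one_eq, map_sub]
  rw [← X]
  noncomm_ring

/-- The `δ`-part of `X b = δ(b) + f(b) X`. -/
noncomputable def delta (D : TwistedTensorProduct k A (Bool → k) Λ) : A →ₗ[k] A :=
  (LinearMap.proj false : (Bool → A) →ₗ[k] A) ∘ₗ D.equiv.symm.toLinearMap ∘ₗ LinearMap.mulLeft k D.X ∘ₗ
    D.inclA.toLinearMap

/-- The `f`-part of `X b = δ(b) + f(b) X`. -/
noncomputable def endo (D : TwistedTensorProduct k A (Bool → k) Λ) : A →ₗ[k] A :=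
  ((LinearMap.proj true : (Bool → A) →ₗ[k] A) - LinearMap.proj false) ∘ₗ D.equiv.symm.toLinearMap ∘ₗ
    LinearMap.mulLeft k D.X ∘ₗ D.inclA.toLinearMap

theorem X_mul (D : TwistedTensorProduct k A (Bool → k) Λ) (b : A) :
    D.X * D.inclA b = D.inclA (D.delta b) + D.inclA (D.endo b) * D.X := by
  have := D.equiv_apply (D.equiv.symm (D.X * D.inclA b))
  rw [LinearEquiv.apply_symm_apply] at this
  exact this

theorem eq_of_add_mul_X (D : TwistedTensorProduct k A (Bool → k) Λ) {b c b' c' : A}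
    (h : D.inclA b + D.inclA c * D.X = D.inclA b' + D.inclA c' * D.X) : b = b' ∧ c = c' := by
  have key : ∀ b c : A, D.inclA b + D.inclA c * D.X =
      D.equiv (fun i => cond i (b + c) b) := by
    intro b c
    rw [equiv_apply]
    simp
  rw [key, key] at h
  have h' := D.equiv.injective h
  have h1 := congrFun h' false
  have h2 := congrFun h' true
  simp only [cond_true, cond_false] at h1 h2
  subst h1
  exact ⟨rfl, add_left_cancel h2⟩

/-- The pair `(f, δ)` determined by a twisted tensor product of `A` and `k^{a,b}` through
`X b = δ(b) + f(b) X`. -/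
noncomputable def interlacing (D : TwistedTensorProduct k A (Bool → k) Λ) :
    TwoInterlacing k A :=
  have hmul : ∀ b c : A, D.delta (b * c) = D.endo b * D.delta c + D.delta b * c ∧
      D.endo (b * c) = D.endo b * D.endo c := by
    intro b c
    apply D.eq_of_add_mul_X
    rw [← D.X_mul, map_mul, ← mul_assoc, D.X_mul, add_mul, mul_assoc _ D.X, D.X_mul]
    simp only [map_add, map_mul]
    noncomm_ring
  have hone : D.delta 1 = 0 ∧ D.endo 1 = 1 := by
    apply D.eq_of_add_mul_X
    rw [← D.X_mul]
    simp
  have hX : ∀ b : A, D.delta b = D.delta (D.delta b) ∧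
      D.endo b = D.endo (D.endo b) + D.delta (D.endo b) + D.endo (D.delta b) := by
    intro b
    apply D.eq_of_add_mul_X
    rw [← D.X_mul]
    nth_rewrite 1 [← D.X_mul_X]
    rw [mul_assoc, D.X_mul, mul_add, ← mul_assoc, D.X_mul, D.X_mul, add_mul, mul_assoc _ D.X,
      D.X_mul_X]
    simp only [map_add, add_mul]
    abel
  { f := AlgHom.ofLinearMap D.endo hone.2 fun b c => (hmul b c).2
    δ := D.delta
    leibniz := fun b c => (hmul b c).1
    idem := fun b => (hX b).1.symm
    rel := fun b => (hX b).2 }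

end TwistedTensorProduct

/-! ### Interlacings of the algebra of a finite set -/

section SetAlgebra

variable {k E : Type*} [Field k] [Fintype E] [DecidableEq E]

theorem exists_setMap (f : (E → k) →ₐ[k] (E → k)) (x : E) :
    ∃ e : E, ∀ b : E → k, f b x = b e := by
  have hsum : ∑ e : E, f (Pi.single e 1) x = 1 := by
    rw [← Finset.sum_apply, ← map_sum]
    have : ∑ e : E, Pi.single e (1 : k) = (1 : E → k) := by
      ext y; simp [Finset.sum_apply, Pi.single_apply]
    rw [this, map_one, Pi.one_apply]
  obtain ⟨e, -, he⟩ := Finset.exists_ne_zero_of_sum_ne_zero (by rw [hsum]; exact one_ne_zero)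
  refine ⟨e, fun b => ?_⟩
  have h1 : Pi.single e (1 : k) * b = b e • Pi.single e (1 : k) := by
    ext y
    by_cases hy : y = e
    · subst hy; simp
    · simp [hy]
  have h2 := congrArg (fun c => f c x) h1
  simp only [map_mul, map_smul, Pi.mul_apply, Pi.smul_apply, smul_eq_mul] at h2
  rw [mul_comm] at h2
  exact mul_right_cancel₀ he h2

/-- The set map `φ : E → E` of an algebra endomorphism `f` of `k^E`:
`f(e) = ∑_{φ(x) = e} x`, that is `f(b)(x) = b(φ(x))`. -/
noncomputable def setMap (f : (E → k) →ₐ[k] (E → k)) (x : E) : E :=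
  (exists_setMap f x).choose

theorem setMap_spec (f : (E → k) →ₐ[k] (E → k)) (b : E → k) (x : E) : f b x = b (setMap f x) :=
  (exists_setMap f x).choose_spec b

namespace TwoInterlacing

/-- The set map of an interlacing `(f, δ)` of `k^E`. -/
noncomputable def φ (Y : TwoInterlacing k (E → k)) : E → E := setMap Y.f

/-- The determining element of `δ`: the `a ∈ k^E` with `δ(b) = (f(b) - b) a` for all `b`,
normalized by `a_e = 0` at loop vertices. -/
noncomputable def determiningElement (Y : TwoInterlacing k (E → k)) : E → k := fun x =>
  if Y.φ x = x then 0 else Y.δ (Pi.single (Y.φ x) 1) x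

theorem determiningElement_spec (Y : TwoInterlacing k (E → k)) (b : E → k) :
    Y.δ b = (Y.f b - b) * Y.determiningElement := by
  ext x
  have h1 : Pi.single (Y.φ x) (1 : k) * b = b (Y.φ x) • Pi.single (Y.φ x) (1 : k) := by
    ext y
    by_cases hy : y = Y.φ x
    · subst hy; simp
    · simp [hy]
  have h2 := congrArg (fun c => Y.δ c x) h1
  simp only [Y.leibniz, map_smul, Pi.mul_apply, Pi.add_apply, Pi.smul_apply, smul_eq_mul,
    setMap_spec Y.f] at h2
  simp only [Pi.mul_apply, Pi.sub_apply, determiningElement, setMap_spec Y.f]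
  change (Pi.single (Y.φ x) (1 : k) : E → k) (Y.φ x) * Y.δ b x + _ = _ at h2
  change _ = (b (Y.φ x) - b x) * _
  rw [Pi.single_eq_same] at h2
  split_ifs with h
  · rw [h] at h2
    linear_combination h2
  · linear_combination h2

theorem determiningElement_loop (Y : TwoInterlacing k (E → k)) (x : E) (hx : Y.φ x = x) :
    Y.determiningElement x = 0 := if_pos hx

end TwoInterlacing

namespace TwistedTensorProduct

variable {Λ : Type*} [Ring Λ] [Algebra k Λ]

/-- The quiver of the set map of a non-commutative duplicate of `E`. -/
abbrev mapQuiver (D : TwistedTensorProduct k (E → k) (Bool → k) Λ) : Type _ :=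
  MapQuiver D.interlacing.φ

/-- The related quiver of a non-commutative duplicate of `E`. -/
abbrev relatedQuiver (D : TwistedTensorProduct k (E → k) (Bool → k) Λ) : Type _ :=
  RelatedQuiver D.interlacing.φ D.interlacing.determiningElement

end TwistedTensorProduct

end SetAlgebra

/-! Combinatorics. Sending each vertex of the related quiver to the source of the arrow ending
there, and fixing the loop vertices, gives a self-map `next` lying over `φ`. The opposite quiver is
the graph of `next` with its fixed points as sinks. Orbits of vertices in one component eventually
merge, so having one sink per component means that every orbit ends in a fixed point
(`isUnionOneSinkOneValued_iff`). Because `E` is finite, the same property of `φ` excludes every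
proper cycle except loops (`hasOnlyLoopCycles_mapQuiver_iff`).

Algebra. Let `u_x` be the idempotent of a point `x`. The element `β_x = u_x X + a_x u_x` satisfies
`u_x β_x u_{φ x} = β_x`, and over a fixed point `l` the idempotent `u_l` splits as `u_l X + u_l (1 -
X)`. Since `a_x` is `0` or `-1` when `φ x = l`, `β_x` starts at exactly one of the two pieces. So
`Λ` is spanned by idempotents and arrows modelled on the related quiver. If all orbits end in fixed
points, the distance to the fixed point is a depth which every arrow raises by one, and each vertex
receives at most one arrow (`exists_isForestBasis`).

Cohomology. Modulo coboundaries a cocycle vanishes when its last argument is a vertex idempotent;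
currying that argument lowers the degree and replaces the coefficients by relative homomorphisms.
Each such shift consumes one unit of depth, and `Λ` has no Peirce component raising the depth by two
or more, so degrees at least two vanish (`mem_bimoduleB_of_depth`). A derivation that kills the
idempotents rescales each arrow, and on a forest any scaling is inner, so degree one vanishes as
well. The centre is the space of functions constant on components. Rank-nullity for the difference
operator along arrows gives `|Q₀| - |Q₁| = c`, so the Euler characteristic is also zero. -/

/-! ### The Hochschild complex with bimodule coefficients -/

section Bimodule

universe u

variable {k : Type*} [CommRing k] {Λ : Type u} [Ring Λ] [Algebra k Λ]

/-- The left action of `Λ` on `Hom_k (Λ, N)`: `(a • h) c = a • h c`. -/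
def homLeft {N : Type u} [AddCommGroup N] [Module k N] (L : Λ →ₗ[k] N →ₗ[k] N) :
    Λ →ₗ[k] (Λ →ₗ[k] N) →ₗ[k] (Λ →ₗ[k] N) :=
  LinearMap.mk₂ k (fun a h => (L a).comp h)
    (fun a b h => by ext; simp) (fun r a h => by ext; simp)
    (fun a h h' => by ext; simp) (fun r a h => by ext; simp)

/-- The right action of `Λ` on `Hom_k (Λ, N)`: `(h • b) c = h (b * c) - h b • c`. -/
def homRight {N : Type u} [AddCommGroup N] [Module k N] (R : Λ →ₗ[k] N →ₗ[k] N) :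
    Λ →ₗ[k] (Λ →ₗ[k] N) →ₗ[k] (Λ →ₗ[k] N) :=
  LinearMap.mk₂ k (fun b h => h.comp (LinearMap.mulLeft k b) - R.flip (h b))
    (fun a b h => by ext; simp [add_mul, sub_add_sub_comm]) (fun r a h => by ext; simp [smul_sub])
    (fun a h h' => by ext; simp [sub_add_sub_comm]) (fun r a h => by ext; simp [smul_sub])

section

variable {N : Type u} [AddCommGroup N] [Module k N]

@[simp] theorem homLeft_apply (L : Λ →ₗ[k] N →ₗ[k] N) (a : Λ) (h : Λ →ₗ[k] N) (c : Λ) :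
    homLeft L a h c = L a (h c) := rfl

@[simp] theorem homRight_apply (R : Λ →ₗ[k] N →ₗ[k] N) (b : Λ) (h : Λ →ₗ[k] N) (c : Λ) :
    homRight R b h c = h (b * c) - R c (h b) := rfl

end

/-- The Hochschild differential with coefficients in a `k`-module with a left action `L` and a
right action `R` of `Λ`, by recursion through `C^{n+1}(Λ, N) = C^n(Λ, Hom_k (Λ, N))`. -/
def bimoduleD : (n : ℕ) → {N : Type u} → [AddCommGroup N] → [Module k N] →
    (L R : Λ →ₗ[k] N →ₗ[k] N) →
    MultilinearMap k (fun _ : Fin n => Λ) N →ₗ[k] MultilinearMap k (fun _ : Fin (n + 1) => Λ) N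
  | 0, N, _, _, L, R =>
    { toFun := fun g => (MultilinearMap.ofSubsingleton k Λ N (0 : Fin 1)) ((L - R).flip (g 0))
      map_add' := fun g h => by ext; simp
      map_smul' := fun r g => by ext; simp [smul_sub] }
  | n + 1, N, _, _, L, R =>
    (multilinearCurryRightEquiv k (fun _ : Fin (n + 2) => Λ) N).symm.toLinearMap ∘ₗ
      bimoduleD n (homLeft L) (homRight R) ∘ₗ
      (multilinearCurryRightEquiv k (fun _ : Fin (n + 1) => Λ) N).toLinearMap

section

variable {N : Type u} [AddCommGroup N] [Module k N]

theorem bimoduleD_succ {n : ℕ} (L R : Λ →ₗ[k] N →ₗ[k] N)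
    (g : MultilinearMap k (fun _ : Fin (n + 1) => Λ) N) :
    bimoduleD (n + 1) L R g =
      (bimoduleD n (homLeft L) (homRight R) g.curryRight).uncurryRight := rfl

theorem curryRight_bimoduleD {n : ℕ} (L R : Λ →ₗ[k] N →ₗ[k] N)
    (g : MultilinearMap k (fun _ : Fin (n + 1) => Λ) N) :
    (bimoduleD (n + 1) L R g).curryRight =
      bimoduleD n (homLeft L) (homRight R) g.curryRight := by
  rw [bimoduleD_succ, MultilinearMap.curry_uncurryRight]

theorem contractNth_castSucc_snoc {n : ℕ} (i : Fin n) (m : Fin (n + 1) → Λ) (c : Λ) :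
    Fin.contractNth i.castSucc.castSucc (· * ·) (Fin.snoc m c : Fin (n + 2) → Λ) =
      (Fin.snoc (Fin.contractNth i.castSucc (· * ·) m) c : Fin (n + 1) → Λ) := by
  ext q
  refine Fin.lastCases ?_ (fun q => ?_) q
  · rw [Fin.snoc_last, Fin.contractNth_apply_of_gt]
    · exact Fin.snoc_last ..
    · simp
  · rw [Fin.snoc_castSucc]
    simp only [Fin.contractNth, Fin.val_castSucc, ← Fin.castSucc_succ, Fin.snoc_castSucc]
    

theorem contractNth_last_snoc {n : ℕ} (m : Fin (n + 1) → Λ) (c : Λ) :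
    Fin.contractNth (Fin.last n).castSucc (· * ·) (Fin.snoc m c : Fin (n + 2) → Λ) =
      (Fin.snoc (Fin.init m) (m (Fin.last n) * c) : Fin (n + 1) → Λ) := by
  ext q
  refine Fin.lastCases ?_ (fun q => ?_) q
  · rw [Fin.snoc_last, Fin.contractNth_apply_of_eq _ _ _ _ (by simp), Fin.snoc_castSucc,
      Fin.succ_last, Fin.snoc_last]
  · rw [Fin.snoc_castSucc, Fin.contractNth_apply_of_lt _ _ _ _ (by simp), Fin.snoc_castSucc]
    rfl

/-- After the last argument is split off, the two summands of `homRight` become the last inner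
product term and the outer right term, with opposite signs; all other terms are already those of the
lower degree. -/
theorem bimoduleD_apply {n : ℕ} (L R : Λ →ₗ[k] N →ₗ[k] N)
    (g : MultilinearMap k (fun _ : Fin n => Λ) N) (m : Fin (n + 1) → Λ) :
    bimoduleD n L R g m = L (m 0) (g (Fin.tail m)) +
      ∑ i : Fin n, (-1 : k) ^ ((i : ℕ) + 1) • g (Fin.contractNth i.castSucc (· * ·) m) +
      (-1 : k) ^ (n + 1) • R (m (Fin.last n)) (g (Fin.init m)) := by
  induction n generalizing N with
  | zero =>
    have h0 : ∀ p : Fin 0 → Λ, g p = g 0 := fun p => by rw [Subsingleton.elim p 0]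
    rw [h0 (Fin.tail m), h0 (Fin.init m)]
    simp [bimoduleD, sub_eq_add_neg]
  | succ n ih =>
    obtain ⟨m, c, rfl⟩ : ∃ (m' : Fin (n + 1) → Λ) (c : Λ), m = Fin.snoc m' c :=
      ⟨Fin.init m, m (Fin.last _), (Fin.snoc_init_self m).symm⟩
    rw [bimoduleD_succ, MultilinearMap.uncurryRight_apply, ih, Fin.sum_univ_castSucc,
      contractNth_last_snoc]
    simp only [contractNth_castSucc_snoc, Fin.init_snoc, Fin.snoc_last, LinearMap.add_apply,
      LinearMap.sum_apply, LinearMap.smul_apply, homLeft_apply, homRight_apply,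
      MultilinearMap.curryRight_apply, Fin.val_castSucc, Fin.val_last, smul_sub]
    have h1 : (Fin.snoc m c : Fin (n + 2) → Λ) 0 = m 0 := Fin.snoc_apply_zero ..
    have h2 : Fin.tail (Fin.snoc m c : Fin (n + 2) → Λ) = Fin.snoc (Fin.tail m) c := by
      ext q
      refine Fin.lastCases ?_ (fun q => ?_) q
      · rw [Fin.snoc_last, Fin.tail, Fin.succ_last, Fin.snoc_last]
      · rw [Fin.snoc_castSucc, Fin.tail, Fin.succ_castSucc, Fin.snoc_castSucc]
        rfl
    have h3 : (Fin.snoc (Fin.init m) (m (Fin.last n)) : Fin (n + 1) → Λ) = m :=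
      Fin.snoc_init_self m
    rw [h1, h2, h3, pow_succ (-1 : k) (n + 1), mul_neg, mul_one, neg_smul]
    generalize (∑ i : Fin n, _ : N) = B
    abel

/-- The axioms of a (not necessarily unital) bimodule. -/
structure IsBimodule (L R : Λ →ₗ[k] N →ₗ[k] N) : Prop where
  left_mul : ∀ a b x, L (a * b) x = L a (L b x)
  right_mul : ∀ a b x, R (a * b) x = R b (R a x)
  comm : ∀ a b x, L a (R b x) = R b (L a x)

theorem IsBimodule.hom {L R : Λ →ₗ[k] N →ₗ[k] N} (h : IsBimodule L R) :
    IsBimodule (homLeft L) (homRight R) where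
  left_mul a b x := by ext; simp [h.left_mul]
  right_mul a b x := by ext; simp [h.right_mul, mul_assoc]
  comm a b x := by ext; simp [h.comm]

theorem bimoduleD_bimoduleD {n : ℕ} {L R : Λ →ₗ[k] N →ₗ[k] N} (h : IsBimodule L R)
    (g : MultilinearMap k (fun _ : Fin n => Λ) N) :
    bimoduleD (n + 1) L R (bimoduleD n L R g) = 0 := by
  induction n generalizing N with
  | zero =>
    ext m
    have h0 : ∀ p : Fin 0 → Λ, g p = g 0 := fun p => by rw [Subsingleton.elim p 0]
    simp [bimoduleD_apply, h0, h.left_mul, h.right_mul, h.comm, Fin.tail, Fin.init,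
      Fin.contractNth]
    abel
  | succ n ih =>
    rw [bimoduleD_succ, curryRight_bimoduleD, ih h.hom]
    rfl

/-- The map `T` need not respect the right actions. Only the last term of the differential sees that
action, so the whole defect sits there. -/
theorem bimoduleD_compMultilinearMap {N' : Type u} [AddCommGroup N'] [Module k N'] {n : ℕ}
    {L R : Λ →ₗ[k] N →ₗ[k] N} {L' R' : Λ →ₗ[k] N' →ₗ[k] N'} (T : N →ₗ[k] N')
    (hL : ∀ a x, T (L a x) = L' a (T x))
    (g : MultilinearMap k (fun _ : Fin n => Λ) N) (m : Fin (n + 1) → Λ) :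
    bimoduleD n L' R' (T.compMultilinearMap g) m = T (bimoduleD n L R g m) +
      (-1 : k) ^ (n + 1) • (R' (m (Fin.last n)) (T (g (Fin.init m))) -
        T (R (m (Fin.last n)) (g (Fin.init m)))) := by
  simp only [bimoduleD_apply, LinearMap.compMultilinearMap_apply, map_add, map_sum, map_smul, hL,
    smul_sub]
  abel

end

/-! ### Normalisation at the idempotents and vanishing by depth -/

section Separable

variable {V : Type*} {e : V → Λ}

variable {N : Type u} [AddCommGroup N] [Module k N]

/-- The map `h ↦ ∑ v, h (e v) • e v`. -/
def homTrace [Fintype V] (e : V → Λ) (R : Λ →ₗ[k] N →ₗ[k] N) : (Λ →ₗ[k] N) →ₗ[k] N :=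
  ∑ v, R (e v) ∘ₗ LinearMap.applyₗ (e v)

theorem homTrace_apply [Fintype V] (R : Λ →ₗ[k] N →ₗ[k] N) (h : Λ →ₗ[k] N) :
    homTrace e R h = ∑ v, R (e v) (h (e v)) := by
  simp [homTrace]

/-- A cocycle is cohomologous to one that vanishes if the last argument is one of the given
orthogonal idempotents. -/
theorem exists_sub_bimoduleD_snoc_eq_zero [Fintype V] (he : CompleteOrthogonalIdempotents e) {n : ℕ}
    {L R : Λ →ₗ[k] N →ₗ[k] N} (hb : IsBimodule L R) (hR : ∀ x, R 1 x = x)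
    {f : MultilinearMap k (fun _ : Fin (n + 1) => Λ) N} (hf : bimoduleD (n + 1) L R f = 0) :
    ∃ g : MultilinearMap k (fun _ : Fin n => Λ) N, ∀ m w,
      (f - bimoduleD n L R g).curryRight m (e w) = 0 := by
  classical
  -- This contracts with the separability idempotent `∑ e v ⊗ e v` of the span of the `e v`. The
  -- sign cancels the one in front of the right action in the differential.
  refine ⟨(-1 : k) ^ (n + 1) • (homTrace e R).compMultilinearMap f.curryRight, fun m w => ?_⟩
  have hc : bimoduleD n (homLeft L) (homRight R) f.curryRight = 0 := by
    rw [← curryRight_bimoduleD, hf]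
    rfl
  -- The trace respects left actions only; its failure to respect the right action of `e w` is
  -- precisely evaluation at `e w`.
  have key : ∀ h : Λ →ₗ[k] N, R (e w) (homTrace e R h) - homTrace e R (homRight R (e w) h) =
      h (e w) := by
    intro h
    have h1 : ∀ v, R (e w) (R (e v) (h (e v))) = R (e v) (h (e w * e v)) := by
      intro v
      rw [← hb.right_mul]
      by_cases hv : v = w
      · subst hv
        rw [(he.idem v).eq]
      · rw [he.ortho hv, he.ortho (Ne.symm hv)]
        simp
    have h2 : ∑ v, R (e v) (h (e w)) = h (e w) := by
      rw [← LinearMap.sum_apply, ← map_sum, he.complete, hR]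
    simp [homTrace_apply, h1, ← hb.right_mul, (he.idem _).eq, h2]
  rw [MultilinearMap.curryRight_apply, sub_apply, map_smul,
    smul_apply, bimoduleD_compMultilinearMap (L := homLeft L) (R := homRight R), hc]
  · simp only [zero_apply, map_zero, zero_add, Fin.snoc_last, Fin.init_snoc, key,
      smul_smul, ← pow_add, ← two_mul, pow_mul]
    simp
  · intro a x
    simp [homTrace_apply, hb.comm]

/-- The right `e`-linear maps `Λ → N` that vanish at all `e v`. -/
def relativeHom (e : V → Λ) (R : Λ →ₗ[k] N →ₗ[k] N) : Submodule k (Λ →ₗ[k] N) where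
  carrier := {h | ∀ w, h (e w) = 0 ∧ ∀ c, h (c * e w) = R (e w) (h c)}
  add_mem' := fun ha hb w => ⟨by simp [(ha w).1, (hb w).1], fun c => by simp [(ha w).2, (hb w).2]⟩
  zero_mem' := by simp
  smul_mem' := fun r h hh w => ⟨by simp [(hh w).1], fun c => by simp [(hh w).2]⟩

theorem homLeft_mem {L R : Λ →ₗ[k] N →ₗ[k] N} (hb : IsBimodule L R) (a : Λ)
    {h : Λ →ₗ[k] N} (hh : h ∈ relativeHom e R) : homLeft L a h ∈ relativeHom e R :=
  fun w => ⟨by simp [(hh w).1], fun c => by simp [(hh w).2, hb.comm]⟩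

theorem homRight_mem {L R : Λ →ₗ[k] N →ₗ[k] N} (hb : IsBimodule L R) (a : Λ)
    {h : Λ →ₗ[k] N} (hh : h ∈ relativeHom e R) : homRight R a h ∈ relativeHom e R :=
  fun w => ⟨by simp [(hh w).2], fun c => by
    simp [(hh w).2, hb.right_mul, ← mul_assoc]⟩

/-- The restriction of an action on `Hom_k (Λ, N)` to a stable submodule. -/
def restrictAction {M : Type u} [AddCommGroup M] [Module k M] (P : Submodule k M)
    (B : Λ →ₗ[k] M →ₗ[k] M) (h : ∀ a, ∀ x ∈ P, B a x ∈ P) : Λ →ₗ[k] P →ₗ[k] P :=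
  LinearMap.mk₂ k (fun a x => ⟨B a x, h a x x.2⟩)
    (fun a b h => by ext; simp) (fun r a h => by ext; simp)
    (fun a h h' => by ext; simp) (fun r a h => by ext; simp)

@[simp] theorem coe_restrictAction {M : Type u} [AddCommGroup M] [Module k M] {P : Submodule k M}
    {B : Λ →ₗ[k] M →ₗ[k] M} (h : ∀ a, ∀ x ∈ P, B a x ∈ P) (a : Λ) (x : P) :
    (restrictAction P B h a x : M) = B a x := rfl

/-- The coboundaries in the complex with coefficients in a bimodule. -/
def bimoduleB : (n : ℕ) → (L R : Λ →ₗ[k] N →ₗ[k] N) →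
    Submodule k (MultilinearMap k (fun _ : Fin n => Λ) N)
  | 0, _, _ => ⊥
  | n + 1, L, R => LinearMap.range (bimoduleD n L R)

/-- If `Λ` is spanned by the `e v` and by elements that raise the depth by one, and no element
of `N` raises the depth by `n`, then all cocycles of degree `n` with coefficients in `N` are
coboundaries. -/
theorem mem_bimoduleB_of_depth [Fintype V] (he : CompleteOrthogonalIdempotents e) (depth : V → ℕ)
    {I : Type*} {α : I → Λ} {s t : I → V} (hspan : Submodule.span k (Set.range e ∪ Set.range α) = ⊤)
    (hs : ∀ i, α i * e (s i) = α i) (ht : ∀ i, e (t i) * α i = α i)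
    (hst : ∀ i, depth (t i) = depth (s i) + 1) {n : ℕ} {L R : Λ →ₗ[k] N →ₗ[k] N}
    (hb : IsBimodule L R) (hL : ∀ x, L 1 x = x) (hR : ∀ x, R 1 x = x)
    (hN : ∀ v w, depth v = depth w + n → ∀ x, L (e v) (R (e w) x) = 0)
    {f : MultilinearMap k (fun _ : Fin n => Λ) N} (hf : bimoduleD n L R f = 0) :
    f ∈ bimoduleB n L R := by
  classical
  induction n generalizing N with
  | zero =>
    have h1 : ∀ a, L a (f 0) = R a (f 0) := by
      intro a
      have := congrArg (fun F => F (fun _ => a)) hf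
      simpa [bimoduleD, sub_eq_zero] using this
    have h2 : f 0 = 0 := by
      -- A cocycle of degree zero is central, so it is the sum of its diagonal components `e v * f 0
      -- * e v`, which do not change the depth and vanish by `hN`.
      rw [← hL (f 0), ← he.complete, map_sum, LinearMap.sum_apply]
      refine Finset.sum_eq_zero fun v _ => ?_
      rw [← (he.idem v).eq, hb.left_mul, h1, hN v v rfl]
    change f = 0
    ext m
    rw [Subsingleton.elim m 0, h2]
    rfl
  | succ n ih =>
    obtain ⟨g, hg⟩ := exists_sub_bimoduleD_snoc_eq_zero he hb hR hf
    set F := f - bimoduleD n L R g with hF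
    have hFc : bimoduleD n (homLeft L) (homRight R) F.curryRight = 0 := by
      rw [← curryRight_bimoduleD, hF, map_sub, hf, bimoduleD_bimoduleD hb, sub_zero]
      rfl
    have hmem : ∀ m, F.curryRight m ∈ relativeHom e R := by
      intro m w
      refine ⟨hg m w, fun c => ?_⟩
      -- In the cocycle identity with final argument `e w`, normalisation kills every term except `F
      -- (m, c * e w)` and `F (m, c) * e w`.
      have h := congrArg (fun G => G (Fin.snoc m c) (e w)) hFc
      simp only [bimoduleD_apply, LinearMap.add_apply, homLeft_apply, hg, map_zero,
        LinearMap.sum_apply, LinearMap.smul_apply, smul_zero, Finset.sum_const_zero, zero_add,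
        Fin.snoc_last, Fin.init_snoc, homRight_apply, zero_apply,
        LinearMap.zero_apply] at h
      have h' := congrArg (fun x => (-1 : k) ^ (n + 1) • x) h
      simp only [smul_smul, ← pow_add, ← two_mul, pow_mul] at h'
      simpa [sub_eq_zero] using h'
    let P := relativeHom e R
    let L' := restrictAction P (homLeft L) fun a x hx => homLeft_mem hb a hx
    let R' := restrictAction P (homRight R) fun a x hx => homRight_mem hb a hx
    let F' : MultilinearMap k (fun _ : Fin n => Λ) P := F.curryRight.codRestrict P hmem
    have hnat : ∀ {j : ℕ} (G : MultilinearMap k (fun _ : Fin j => Λ) P),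
        P.subtype.compMultilinearMap (bimoduleD j L' R' G) =
          bimoduleD j (homLeft L) (homRight R) (P.subtype.compMultilinearMap G) := by
      intro j G
      ext m : 1
      rw [bimoduleD_compMultilinearMap (L := L') (R := R') P.subtype (fun _ _ => rfl)]
      simp [R']
    have hF' : bimoduleD n L' R' F' = 0 := by
      have : P.subtype.compMultilinearMap (bimoduleD n L' R' F') = 0 := by
        rw [hnat, ← hFc]
        rfl
      ext m : 1
      exact Subtype.ext (congrArg (fun G => G m) this)
    have hb' : IsBimodule L' R' :=
      { left_mul := fun a b x => Subtype.ext (hb.hom.left_mul a b x)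
        right_mul := fun a b x => Subtype.ext (hb.hom.right_mul a b x)
        comm := fun a b x => Subtype.ext (hb.hom.comm a b x) }
    have hL' : ∀ x, L' 1 x = x := fun x => by ext; simp [L', hL]
    have hR' : ∀ x, R' 1 x = x := by
      intro x
      ext c
      -- On `Hom_k (Λ, N)` the unit acts on the right by subtracting the contribution of the value
      -- at `1`; relative maps vanish there, so on them the action is unital.
      have : (x : Λ →ₗ[k] N) 1 = 0 := by
        rw [← he.complete, map_sum]
        exact Finset.sum_eq_zero fun v _ => (x.2 v).1
      simp [R', this]
    -- A relative map is tested on the spanning set. It vanishes at idempotents, and at an arrow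
    -- ending at `w` its value lies over the source, which is one level lower. Hence a rise by `n`
    -- for maps becomes a rise by `n + 1` in `N`.
    have hN' : ∀ v w, depth v = depth w + n → ∀ x, L' (e v) (R' (e w) x) = 0 := by
      intro v w hvw x
      apply Subtype.ext
      refine LinearMap.ext_on hspan ?_
      rintro _ (⟨u, rfl⟩ | ⟨i, rfl⟩)
      · simp only [L', R', coe_restrictAction, homLeft_apply, homRight_apply, he.mul_eq, (x.2 w).1]
        split_ifs <;> simp [(x.2 w).1]
      · simp only [L', R', coe_restrictAction, homLeft_apply, homRight_apply, (x.2 w).1, map_zero,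
          sub_zero]
        by_cases hw : w = t i
        · subst hw
          rw [ht, ← hs, (x.2 _).2, hN _ _ (by rw [hvw, hst]; ring)]
          rfl
        · rw [← ht, ← mul_assoc, he.ortho hw]
          simp
    have hB := ih hb' hL' hR' hN' hF'
    suffices h : F ∈ LinearMap.range (bimoduleD n L R) by
      have := Submodule.add_mem _ h (LinearMap.mem_range_self (bimoduleD n L R) g)
      rwa [hF, sub_add_cancel] at this
    -- In degree zero being a coboundary means being zero, so that case does not provide a preimage
    -- to uncurry.
    cases n with
    | zero =>
      have h0 : F' = 0 := hB
      have : F = 0 := by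
        rw [← MultilinearMap.uncurry_curryRight F]
        have : F.curryRight = P.subtype.compMultilinearMap F' := rfl
        rw [this, h0]
        rfl
      rw [this]
      exact Submodule.zero_mem _
    | succ n =>
      obtain ⟨G, hG⟩ := hB
      refine ⟨(P.subtype.compMultilinearMap G).uncurryRight, ?_⟩
      rw [bimoduleD_succ, MultilinearMap.curry_uncurryRight, ← hnat, hG]
      exact MultilinearMap.uncurry_curryRight F

end Separable

section Regular

variable (k Λ) in
/-- The Hochschild differential is the one with coefficients in the regular bimodule. -/
theorem hochschildD_eq_bimoduleD (n : ℕ) :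
    hochschildD k Λ n = bimoduleD n (LinearMap.mul k Λ) (LinearMap.mul k Λ).flip := by
  ext g m
  rw [bimoduleD_apply]
  simp [hochschildD, HochschildCochain.leftTerm, HochschildCochain.middleTerm,
    HochschildCochain.rightTerm]
  rfl

theorem isBimodule_mul : IsBimodule (LinearMap.mul k Λ) (LinearMap.mul k Λ).flip where
  left_mul a b x := by simp [mul_assoc]
  right_mul a b x := by simp [mul_assoc]
  comm a b x := by simp [mul_assoc]

end Regular

end Bimodule

/-! ### Cohomology of an algebra spanned by a forest -/

section GradedBasis

universe u

/-- The algebra `Λ` is spanned by complete orthogonal idempotents `e v` and elements `α i` with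
`α i = e (t i) * α i * e (s i)`, where `t` is injective and raises the depth by one. -/
structure IsForestBasis (k : Type*) [Field k] {Λ : Type u} [Ring Λ] [Algebra k Λ] {V I : Type*}
    [Fintype V] (e : V → Λ) (α : I → Λ) (s t : I → V) (depth : V → ℕ) : Prop where
  idem : CompleteOrthogonalIdempotents e
  mul_source : ∀ i, α i * e (s i) = α i
  target_mul : ∀ i, e (t i) * α i = α i
  vertex_ne_zero : ∀ v, e v ≠ 0
  arrow_ne_zero : ∀ i, α i ≠ 0
  span_eq : Submodule.span k (Set.range e ∪ Set.range α) = ⊤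
  target_injective : Function.Injective t
  depth_target : ∀ i, depth (t i) = depth (s i) + 1

variable {k : Type*} [Field k] {Λ : Type u} [Ring Λ] [Algebra k Λ]

theorem subsingleton_hochschildCohomology {n : ℕ}
    (h : ∀ f, hochschildD k Λ n f = 0 → f ∈ hochschildB k Λ n) :
    Subsingleton (HochschildCohomology k Λ n) := by
  refine Submodule.Quotient.subsingleton_iff.2 ?_
  rw [eq_top_iff]
  rintro ⟨f, hf⟩ -
  exact h f hf

variable {V I : Type*} {e : V → Λ} {α : I → Λ} {s t : I → V} {depth : V → ℕ}

variable (k s t) in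
/-- The difference of the values of a function at the ends of each arrow. -/
def arrowDifference : (V → k) →ₗ[k] (I → k) :=
  LinearMap.funLeft k k t - LinearMap.funLeft k k s

@[simp] theorem arrowDifference_apply (c : V → k) (i : I) :
    arrowDifference k s t c i = c (t i) - c (s i) := rfl

/-- Each vertex ends at most one arrow, and that arrow starts one level lower, so the values of `c`
can be chosen level by level without conflict. -/
theorem arrowDifference_surjective [Finite I] (ht : Function.Injective t)
    (hd : ∀ i, depth (t i) = depth (s i) + 1) :
    Function.Surjective (arrowDifference k s t) := by
  classical
  intro d
  have key : ∀ n, ∃ c : V → k, ∀ i, depth (t i) ≤ n → c (t i) - c (s i) = d i := by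
    intro n
    induction n with
    | zero => exact ⟨0, fun i hi => by have := hd i; omega⟩
    | succ n ih =>
      obtain ⟨c, hc⟩ := ih
      refine ⟨fun v => if h : ∃ i, t i = v ∧ depth v = n + 1 then
        c (s h.choose) + d h.choose else c v, fun i hi => ?_⟩
      -- The source has depth at most `n`, so its value is left as it was.
      have hs : ¬ ∃ j, t j = s i ∧ depth (s i) = n + 1 := by
        rintro ⟨j, -, hj⟩
        have := hd i
        omega
      simp only [dif_neg hs]
      by_cases h : depth (t i) = n + 1
      · have h' : ∃ j, t j = t i ∧ depth (t i) = n + 1 := ⟨i, rfl, h⟩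
        rw [dif_pos h', ht h'.choose_spec.1]
        ring
      · rw [dif_neg (fun ⟨_, _, h'⟩ => h h')]
        exact hc i (by omega)
  have := Fintype.ofFinite I
  obtain ⟨c, hc⟩ := key (Finset.univ.sup fun i => depth (t i))
  exact ⟨c, funext fun i => hc i (Finset.le_sup (f := fun i => depth (t i)) (Finset.mem_univ i))⟩

namespace IsForestBasis

variable [Fintype V] (H : IsForestBasis k e α s t depth)

include H

theorem source_ne_target (i : I) : s i ≠ t i := by
  intro h
  have := H.depth_target i
  rw [h] at this
  omega

theorem mul_arrow {v : V} {i : I} (h : v ≠ t i) : e v * α i = 0 := by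
  rw [← H.target_mul, ← mul_assoc, H.idem.ortho h, zero_mul]

theorem arrow_mul {v : V} {i : I} (h : s i ≠ v) : α i * e v = 0 := by
  rw [← H.mul_source, mul_assoc, H.idem.ortho h, mul_zero]

/-- To show that the Peirce component `e v * z * e w` lies in a subspace it is enough to do so
for basis elements `z`. -/
theorem mul_mul_mem {v w : V} (P : Submodule k Λ) (hv : v = w → e v ∈ P)
    (hα : ∀ i, v = t i → s i = w → α i ∈ P) (z : Λ) : e v * z * e w ∈ P := by
  classical
  have hz : z ∈ Submodule.span k (Set.range e ∪ Set.range α) := by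
    rw [H.span_eq]
    trivial
  induction hz using Submodule.span_induction with
  | mem z hz =>
    rcases hz with ⟨u, rfl⟩ | ⟨i, rfl⟩
    · rw [H.idem.mul_eq]
      split_ifs with h1
      · rw [H.idem.mul_eq]
        split_ifs with h2
        · exact hv h2
        · exact P.zero_mem
      · simp
    · by_cases h1 : v = t i
      · by_cases h2 : s i = w
        · subst h1 h2
          rw [H.target_mul, H.mul_source]
          exact hα i rfl rfl
        · rw [mul_assoc, H.arrow_mul h2]
          simp
      · rw [H.mul_arrow h1]
        simp
  | zero => simp
  | add x y _ _ hx hy =>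
    rw [mul_add, add_mul]
    exact P.add_mem hx hy
  | smul r x _ hx =>
    rw [mul_smul_comm, smul_mul_assoc]
    exact P.smul_mem r hx

theorem exists_vertex_mul_mul (v : V) (z : Λ) : ∃ c : k, c • e v = e v * z * e v := by
  rw [← Submodule.mem_span_singleton]
  refine H.mul_mul_mem _ (fun _ => Submodule.mem_span_singleton_self _) (fun i h1 h2 => ?_) z
  exact absurd (h2.trans h1) (H.source_ne_target i)

/-- Injectivity of `t` makes `α i` the only arrow in this Peirce component, and the absence of loops
excludes idempotents. -/
theorem exists_target_mul_mul (i : I) (z : Λ) : ∃ c : k, c • α i = e (t i) * z * e (s i) := by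
  rw [← Submodule.mem_span_singleton]
  refine H.mul_mul_mem _ (fun h => absurd h.symm (H.source_ne_target i)) (fun j h1 _ => ?_) z
  rw [H.target_injective h1]
  exact Submodule.mem_span_singleton_self _

theorem mul_mul_eq_zero {v w : V} {n : ℕ} (h : depth v = depth w + (n + 2)) (z : Λ) :
    e v * z * e w = 0 := by
  rw [← Submodule.mem_bot k]
  refine H.mul_mul_mem _ ?_ ?_ z
  · rintro rfl
    omega
  · rintro i rfl rfl
    have := H.depth_target i
    omega

theorem vertex_mul_sum (c : V → k) (w : V) : e w * ∑ v, c v • e v = c w • e w := by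
  classical
  simp [Finset.mul_sum, H.idem.mul_eq]

theorem sum_mul_vertex (c : V → k) (w : V) : (∑ v, c v • e v) * e w = c w • e w := by
  classical
  simp [Finset.sum_mul, H.idem.mul_eq]

theorem arrow_mul_sum (c : V → k) (i : I) : α i * ∑ v, c v • e v = c (s i) • α i := by
  rw [← H.mul_source i, mul_assoc, H.vertex_mul_sum, mul_smul_comm]

theorem sum_mul_arrow (c : V → k) (i : I) : (∑ v, c v • e v) * α i = c (t i) • α i := by
  rw [← H.target_mul i, ← mul_assoc, H.sum_mul_vertex, smul_mul_assoc]

theorem subsingleton_of_two_le {n : ℕ} (hn : 2 ≤ n) :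
    Subsingleton (HochschildCohomology k Λ n) := by
  obtain ⟨n, rfl⟩ := Nat.exists_eq_add_of_le' hn
  refine subsingleton_hochschildCohomology fun f hf => ?_
  have := mem_bimoduleB_of_depth (k := k) (n := n + 2) H.idem depth H.span_eq H.mul_source
    H.target_mul H.depth_target isBimodule_mul (fun x => by simp) (fun x => by simp)
    (fun v w hvw x => by simpa [mul_assoc] using H.mul_mul_eq_zero hvw x)
    (by rw [← hochschildD_eq_bimoduleD, hf])
  change f ∈ LinearMap.range _
  rw [hochschildD_eq_bimoduleD]
  exact this

/-- A derivation killing the idempotents multiplies each arrow by a scalar `d i`. Writing `d` as a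
difference `c ∘ t - c ∘ s` exhibits it as the commutator with `∑ c v • e v`. -/
theorem subsingleton_one [Finite I] : Subsingleton (HochschildCohomology k Λ 1) := by
  refine subsingleton_hochschildCohomology fun f hf => ?_
  change f ∈ LinearMap.range (hochschildD k Λ 0)
  rw [hochschildD_eq_bimoduleD] at hf ⊢
  obtain ⟨g, hg⟩ := exists_sub_bimoduleD_snoc_eq_zero H.idem (k := k) isBimodule_mul
    (fun x => by simp) hf
  have hF : bimoduleD 1 (LinearMap.mul k Λ) (LinearMap.mul k Λ).flip
      (f - bimoduleD 0 (LinearMap.mul k Λ) (LinearMap.mul k Λ).flip g) = 0 := by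
    rw [map_sub, hf, bimoduleD_bimoduleD isBimodule_mul, sub_zero]
  set F := f - bimoduleD 0 (LinearMap.mul k Λ) (LinearMap.mul k Λ).flip g with hFdef
  suffices h : F ∈ LinearMap.range (bimoduleD 0 (LinearMap.mul k Λ) (LinearMap.mul k Λ).flip) by
    have := Submodule.add_mem _ h (LinearMap.mem_range_self _ g)
    rwa [hFdef, sub_add_cancel] at this
  let D : Λ →ₗ[k] Λ := F.curryRight 0
  have hDF : ∀ m, F m = D (m 0) := by
    intro m
    change F m = F (Fin.snoc 0 (m 0))
    congr 1
    ext q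
    rw [Subsingleton.elim q 0]
    rfl
  have hD0 : ∀ w, D (e w) = 0 := hg 0
  have hD : ∀ a b, D (a * b) = a * D b + D a * b := by
    intro a b
    have := congrArg (fun G => G ![a, b]) hF
    simp [bimoduleD_apply, hDF, Fin.init, Fin.contractNth] at this
    rw [← sub_eq_zero, ← neg_eq_zero, ← this]
    abel
  have hDα : ∀ i, ∃ c : k, c • α i = D (α i) := by
    intro i
    obtain ⟨c, hc⟩ := H.exists_target_mul_mul i (D (α i))
    refine ⟨c, hc.trans ?_⟩
    -- As `D` vanishes on idempotents, it commutes with multiplication by them on both sides.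
    conv_rhs => rw [← H.mul_source i, hD, hD0, mul_zero, zero_add, ← H.target_mul i, hD, hD0,
      zero_mul, add_zero]
  choose d hd using hDα
  obtain ⟨c, hc⟩ := arrowDifference_surjective (k := k) H.target_injective H.depth_target d
  have hc' : ∀ i, c (t i) - c (s i) = d i := fun i => congrFun hc i
  -- The differential of a constant `z` is `a ↦ a * z - z * a`, whence the minus sign.
  refine ⟨MultilinearMap.constOfIsEmpty k _ (-∑ v, c v • e v), ?_⟩
  let D' : Λ →ₗ[k] Λ := LinearMap.mulLeft k (∑ v, c v • e v) - LinearMap.mulRight k (∑ v, c v • e v)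
  have hDD' : D = D' := by
    refine LinearMap.ext_on H.span_eq ?_
    rintro _ (⟨v, rfl⟩ | ⟨i, rfl⟩)
    · simp [D', hD0, H.vertex_mul_sum, H.sum_mul_vertex]
    · simp [D', ← hd, H.arrow_mul_sum, H.sum_mul_arrow, ← hc', sub_smul]
  ext m
  rw [hDF, hDD', bimoduleD_apply]
  simp [D', Finset.sum_mul, Finset.mul_sum]
  abel

/-- The locally constant functions on the quiver are the Hochschild cocycles of degree zero. -/
noncomputable def kerEquiv :
    LinearMap.ker (arrowDifference k s t) ≃ₗ[k] LinearMap.ker (hochschildD k Λ 0) := by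
  refine LinearEquiv.ofBijective (LinearMap.codRestrict _
    ((MultilinearMap.constLinearEquivOfIsEmpty (R := k) (S := k) (M₁ := fun _ : Fin 0 => Λ)
      (M₂ := Λ)).toLinearMap ∘ₗ Fintype.linearCombination k e ∘ₗ Submodule.subtype _) ?_) ⟨?_, ?_⟩
  · rintro ⟨c, hc⟩
    have hc' : ∀ i, c (t i) = c (s i) := fun i => sub_eq_zero.1 (congrFun hc i)
    rw [LinearMap.mem_ker, hochschildD_eq_bimoduleD]
    ext m
    rw [bimoduleD_apply]
    have h : LinearMap.mulRight k (∑ v, c v • e v) = LinearMap.mulLeft k (∑ v, c v • e v) := by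
      refine LinearMap.ext_on H.span_eq ?_
      rintro _ (⟨v, rfl⟩ | ⟨i, rfl⟩)
      · simp [H.vertex_mul_sum, H.sum_mul_vertex]
      · simp [H.arrow_mul_sum, H.sum_mul_arrow, hc']
    have := congrArg (fun F => F (m 0)) h
    simpa [Finset.sum_mul, Finset.mul_sum, Fintype.linearCombination_apply, ← sub_eq_add_neg, sub_eq_zero] using this
  · rw [injective_iff_map_eq_zero]
    rintro ⟨c, hc⟩ h
    have h' : ∑ v, c v • e v = 0 := congrArg (fun F => F.1 0) h
    ext v
    have := congrArg (fun z => e v * z) h'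
    simpa [H.vertex_mul_sum, H.vertex_ne_zero] using this
  · rintro ⟨f, hf⟩
    have hz : ∀ a, a * f 0 = f 0 * a := by
      intro a
      rw [LinearMap.mem_ker, hochschildD_eq_bimoduleD] at hf
      have := congrArg (fun F => F (fun _ => a)) hf
      simpa [bimoduleD, sub_eq_zero] using this
    -- A central element is the sum of its diagonal Peirce components, each a multiple of `e v`;
    -- commuting with the nonzero `α i` then equates the coefficients at the two ends.
    choose c hc using fun v => H.exists_vertex_mul_mul v (f 0)
    have hsum : ∑ v, c v • e v = f 0 := by
      rw [← one_mul (f 0), ← H.idem.complete, Finset.sum_mul]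
      refine Finset.sum_congr rfl fun v _ => ?_
      rw [hc, mul_assoc, ← hz, ← mul_assoc, (H.idem.idem v).eq]
    have hmem : c ∈ LinearMap.ker (arrowDifference k s t) := by
      rw [LinearMap.mem_ker]
      ext i
      have := hz (α i)
      rw [← hsum, H.arrow_mul_sum, H.sum_mul_arrow, ← sub_eq_zero, ← sub_smul,
        smul_eq_zero, or_iff_left (H.arrow_ne_zero i), sub_eq_zero] at this
      rw [arrowDifference_apply, this]
      simp
    refine ⟨⟨c, hmem⟩, Subtype.ext ?_⟩
    ext m
    rw [Subsingleton.elim m 0, ← hsum]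
    rfl

/-- The Hochschild cohomology of degree zero, as the space of locally constant functions. -/
noncomputable def cohomologyZeroEquiv :
    HochschildCohomology k Λ 0 ≃ₗ[k] LinearMap.ker (arrowDifference k s t) :=
  (Submodule.quotEquivOfEqBot _ (by
    rw [Submodule.submoduleOf, hochschildB, ← LinearMap.ker, Submodule.ker_subtype])) ≪≫ₗ
    H.kerEquiv.symm

end IsForestBasis

/-- This is rank-nullity for a surjective map. Once the kernel is identified with functions on
components, it says that the Euler characteristic of a forest vanishes. -/
theorem finrank_ker_arrowDifference [Fintype V] [Fintype I] (ht : Function.Injective t)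
    (hd : ∀ i, depth (t i) = depth (s i) + 1) :
    Fintype.card I + Module.finrank k (LinearMap.ker (arrowDifference k s t)) =
      Fintype.card V := by
  have h := LinearMap.finrank_range_add_finrank_ker (arrowDifference k s t)
  rw [LinearMap.range_eq_top.2 (arrowDifference_surjective ht hd)] at h
  simpa using h

end GradedBasis

/-! ### Self-maps whose orbits end in fixed points -/

section EventuallyFixed

/-- Every orbit of `g` ends in a fixed point. -/
def IsEventuallyFixed {X : Type*} (g : X → X) : Prop :=
  ∀ x, ∃ n, g (g^[n] x) = g^[n] x

variable {X : Type*} {g : X → X}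

theorem iterate_eq_of_fixed {x : X} (h : g x = x) (n : ℕ) : g^[n] x = x :=
  Function.iterate_fixed h n

theorem IsEventuallyFixed.exists_depth (h : IsEventuallyFixed g) :
    ∃ depth : X → ℕ, ∀ x, g x ≠ x → depth x = depth (g x) + 1 := by
  classical
  exact ⟨fun x => Nat.find (h x), fun x hx => Nat.find_comp_succ (h x) (h (g x)) hx⟩

theorem IsEventuallyFixed.fixed_of_iterate_eq (h : IsEventuallyFixed g) {x : X} {m : ℕ}
    (hm : 0 < m) (hx : g^[m] x = x) : g x = x := by
  obtain ⟨n, hn⟩ := h x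
  -- The exponent `n * m` is a multiple of the period and, as `m` is positive, at least `n`.
  have h1 : g^[n * m] x = x := by
    rw [mul_comm, Function.iterate_mul, iterate_eq_of_fixed hx]
  have h2 : g^[n * m] x = g^[n] x := by
    obtain ⟨j, hj⟩ := Nat.exists_eq_add_of_le' (Nat.le_mul_of_pos_right n hm)
    rw [hj, Function.iterate_add_apply, iterate_eq_of_fixed hn]
  rw [← h1, h2, hn]

theorem component_eq_of_hom {W : Type*} [Quiver W] {v w : W} (f : v ⟶ w) :
    (v : Quiver.WeaklyConnectedComponent W) = w :=
  (Quiver.WeaklyConnectedComponent.eq v w).2 ⟨(Quiver.Symmetrify.of.map f).toPath⟩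

/-- Induction along an unoriented path: crossing an arrow in either direction costs one more
application of `g` on one side. -/
theorem exists_iterate_eq_of_component_eq {W : Type*} [Quiver W] {g : W → W}
    (hg : ∀ v w : W, (v ⟶ w) → w = g v) {v w : W}
    (h : (v : Quiver.WeaklyConnectedComponent W) = w) : ∃ m n, g^[m] v = g^[n] w := by
  obtain ⟨p⟩ := (Quiver.WeaklyConnectedComponent.eq v w).1 h
  clear h
  induction p with
  | nil => exact ⟨0, 0, rfl⟩
  | @cons b c p f ih =>
    obtain ⟨m, n, hmn⟩ := ih
    rcases f with f | f
    · refine ⟨m + 1, n, ?_⟩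
      rw [Function.iterate_succ_apply', hmn, hg _ _ f, ← Function.iterate_succ_apply,
        Function.iterate_succ_apply']
    · refine ⟨m, n + 1, ?_⟩
      rw [hmn, Function.iterate_succ_apply, ← hg _ _ f]

theorem component_iterate_eq {W : Type*} [Quiver W] {g : W → W}
    (hg : ∀ v, g v ≠ v → Nonempty (v ⟶ g v)) (v : W) (n : ℕ) :
    (g^[n] v : Quiver.WeaklyConnectedComponent W) = v := by
  induction n with
  | zero => rfl
  | succ n ih =>
    rw [Function.iterate_succ_apply', ← ih]
    by_cases h : g (g^[n] v) = g^[n] v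
    · rw [h]
    · obtain ⟨f⟩ := hg _ h
      exact (component_eq_of_hom f).symm

/-- A quiver whose arrows go from each `v` that is not fixed by `g` to `g v` is a union of
one-sink-one-valued quivers if and only if every orbit of `g` ends in a fixed point. -/
theorem isUnionOneSinkOneValued_iff {W : Type*} [Quiver W] {g : W → W}
    (hg : ∀ v w : W, (v ⟶ w) → w = g v) (hsink : ∀ v, g v = v → IsSinkVertex v)
    (hval : ∀ v, g v ≠ v → IsOneValuedVertex v) :
    IsUnionOneSinkOneValued W ↔ IsEventuallyFixed g := by
  have harrow : ∀ v, g v ≠ v → Nonempty (v ⟶ g v) := by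
    intro v hv
    obtain ⟨u⟩ := hval v hv
    have f := u.default.2
    rw [hg _ _ f] at f
    exact ⟨f⟩
  have hfix : ∀ v, IsSinkVertex v → g v = v := by
    intro v hv
    by_contra h
    obtain ⟨f⟩ := harrow v h
    exact (hv (g v)).false f
  constructor
  · intro h v
    obtain ⟨⟨w, ⟨hw, hw'⟩, -⟩, -⟩ := h v
    -- The orbit of `v` merges with that of the sink of its component, which is constant.
    obtain ⟨m, n, hmn⟩ := exists_iterate_eq_of_component_eq hg hw.symm
    rw [iterate_eq_of_fixed (hfix w hw')] at hmn
    exact ⟨m, by rw [hmn, hfix w hw']⟩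
  · intro h c
    refine ⟨?_, fun v _ hv => hval v fun h' => hv (hsink v h')⟩
    obtain ⟨v, rfl⟩ : ∃ v : W, (v : Quiver.WeaklyConnectedComponent W) = c :=
      Quotient.exists_rep c
    obtain ⟨n, hn⟩ := h v
    have hc := component_iterate_eq harrow v n
    refine ⟨g^[n] v, ⟨hc, hsink _ hn⟩, ?_⟩
    rintro w ⟨hw, hw'⟩
    obtain ⟨i, j, hij⟩ := exists_iterate_eq_of_component_eq hg (hw.trans hc.symm)
    rwa [iterate_eq_of_fixed hn, iterate_eq_of_fixed (hfix w hw')] at hij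

end EventuallyFixed

/-! ### Cycles in the quiver of a map -/

section MapQuiver

variable {E : Type*} {φ : E → E}

/-- The map `φ` on the vertices of its quiver. -/
def MapQuiver.step (φ : E → E) : MapQuiver φ → MapQuiver φ := φ

theorem MapQuiver.eq_iterate {x y : MapQuiver φ} (p : Quiver.Path x y) :
    y = (step φ)^[p.length] x := by
  induction p with
  | nil => rfl
  | cons p f ih =>
    rw [Quiver.Path.length_cons, Function.iterate_succ_apply', ← ih]
    exact f.down.symm

/-- Every vertex emits exactly one arrow, so the start and the length determine the path. -/
theorem MapQuiver.path_eq {x y : MapQuiver φ} (p q : Quiver.Path x y)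
    (h : p.length = q.length) : p = q := by
  induction p with
  | nil =>
    cases q with
    | nil => rfl
    | cons q f => simp at h
  | @cons b c p f ih =>
    cases q with
    | nil => simp at h
    | @cons b' _ q f' =>
      have hl : p.length = q.length := by simpa using h
      obtain rfl : b = b' := by rw [eq_iterate p, eq_iterate q, hl]
      rw [ih q hl, show f = f' from PLift.down_injective rfl]

theorem MapQuiver.exists_path (x : MapQuiver φ) (n : ℕ) :
    ∃ p : Quiver.Path x ((step φ)^[n] x), p.length = n := by
  induction n with
  | zero => exact ⟨Quiver.Path.nil, rfl⟩
  | succ n ih =>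
    obtain ⟨p, hp⟩ := ih
    have f : (step φ)^[n] x ⟶ (step φ)^[n + 1] x :=
      ⟨(Function.iterate_succ_apply' (step φ) n x).symm⟩
    exact ⟨p.cons f, by rw [Quiver.Path.length_cons, hp]⟩

theorem Quiver.Path.length_iterate {V : Type*} [Quiver V] {x : V} (p : Quiver.Path x x) (m : ℕ) :
    (p.iterate m).length = m * p.length := by
  induction m with
  | zero => simp [Quiver.Path.iterate]
  | succ m ih => rw [Quiver.Path.iterate, Quiver.Path.length_comp, ih, Nat.succ_mul]

/-- By finiteness every orbit becomes periodic. The closed path whose length is the minimal period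
is proper, as a shorter one would give a smaller period; if it is a loop, the orbit has reached a
fixed point. Conversely, a periodic point of an eventually fixed map is fixed, so each cycle
iterates a loop. -/
theorem hasOnlyLoopCycles_mapQuiver_iff [Finite E] :
    HasOnlyLoopCycles (MapQuiver φ) ↔ IsEventuallyFixed φ := by
  change _ ↔ IsEventuallyFixed (MapQuiver.step φ)
  have : Finite (MapQuiver φ) := ‹Finite E›
  constructor
  · intro h x
    have key : ∃ n m, 0 < m ∧
        (MapQuiver.step φ)^[m] ((MapQuiver.step φ)^[n] x) = (MapQuiver.step φ)^[n] x := by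
      obtain ⟨i, j, hij, hx⟩ :=
        Finite.exists_ne_map_eq_of_infinite (fun n : ℕ => (MapQuiver.step φ)^[n] x)
      rcases lt_or_gt_of_ne hij with h | h
      · exact ⟨i, j - i, by omega, by
          rw [← Function.iterate_add_apply, Nat.sub_add_cancel h.le, hx]⟩
      · exact ⟨j, i - j, by omega, by
          rw [← Function.iterate_add_apply, Nat.sub_add_cancel h.le, hx]⟩
    obtain ⟨n, m, hm, hnm⟩ := key
    set y := (MapQuiver.step φ)^[n] x with hydef
    have hper : y ∈ Function.periodicPts (MapQuiver.step φ) := ⟨m, hm, hnm⟩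
    have hy : (MapQuiver.step φ)^[Function.minimalPeriod (MapQuiver.step φ) y] y = y :=
      Function.iterate_minimalPeriod
    obtain ⟨p, hp⟩ : ∃ p : Quiver.Path y y,
        p.length = Function.minimalPeriod (MapQuiver.step φ) y := by
      have := MapQuiver.exists_path y (Function.minimalPeriod (MapQuiver.step φ) y)
      rwa [hy] at this
    have hpos := Function.minimalPeriod_pos_of_mem_periodicPts hper
    refine ⟨n, ?_⟩
    have := h y p ⟨by rw [hp]; exact hpos, fun q m hq hqp _ => ?_⟩
    · rwa [← hp, this] at hy
    · rw [hp] at hqp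
      exact absurd (Function.IsPeriodicPt.minimalPeriod_le hq (MapQuiver.eq_iterate q).symm)
        (not_le.2 hqp)
  · intro h x p hp
    by_contra hlen
    have f : x ⟶ x := ⟨h.fixed_of_iterate_eq hp.1 (MapQuiver.eq_iterate p).symm⟩
    have h1 := hp.1
    refine hp.2 f.toPath p.length (by simp) (by simp; omega) (MapQuiver.path_eq _ _ ?_)
    simp [Quiver.Path.length_iterate]

end MapQuiver

/-! ### Combinatorics of the related quiver -/

namespace RelatedQuiver

variable {k E : Type*} [Ring k] {φ : E → E} {a : E → k}

/-- The target of the arrow of the related quiver given by a non-loop vertex. -/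
def target (x : {x // φ x ≠ x}) : RelatedQuiver φ a := vertex x.1 x.2

/-- The source of the arrow of the related quiver given by a non-loop vertex. -/
noncomputable def source (ha : ∀ x, φ x ≠ x → φ (φ x) = φ x → a x = 0 ∨ a x = -1)
    (x : {x // φ x ≠ x}) : RelatedQuiver φ a :=
  open Classical in
  if h : φ (φ x) = φ x then loopVertex (φ x) h (a x) (ha x x.2 h) else vertex (φ x) h

/-- The projection of the related quiver to the set `E`. -/
def proj : RelatedQuiver φ a → E
  | vertex x _ => x
  | loopVertex l _ _ _ => l

theorem target_injective :
    Function.Injective (target : {x // φ x ≠ x} → RelatedQuiver φ a) :=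
  fun _ _ h => Subtype.ext (congrArg (proj (φ := φ) (a := a)) h)

variable (ha : ∀ x, φ x ≠ x → φ (φ x) = φ x → a x = 0 ∨ a x = -1)

/-- Arrows are thereby indexed by their ends, the non-loop vertices, which matches the indexing of
the arrow elements of the algebra. -/
theorem isArrow_iff (v w : RelatedQuiver φ a) :
    IsArrow v w ↔ ∃ x, source ha x = v ∧ target x = w := by
  cases w with
  | vertex x hx =>
    have h1 : (∃ y, source ha y = v ∧ target y = (vertex x hx : RelatedQuiver φ a)) ↔
        source ha ⟨x, hx⟩ = v := by
      constructor
      · rintro ⟨⟨y, hy⟩, h1, h2⟩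
        obtain rfl : y = x := by simpa [target] using h2
        exact h1
      · exact fun h => ⟨_, h, rfl⟩
    rw [h1, source]
    cases v with
    | vertex y hy =>
      split_ifs with h
      · simp only [IsArrow, iff_false]
        rintro rfl
        exact hy h
      · simp [IsArrow]
    | loopVertex l hl ε hε =>
      split_ifs with h
      · simp [IsArrow]
      · simp only [IsArrow, iff_false]
        rintro ⟨rfl, -⟩
        exact h hl
  | loopVertex l hl ε hε =>
    cases v <;> simp [IsArrow, target]

/-- The map of the related quiver that sends the target of each arrow to its source. -/
noncomputable def next : RelatedQuiver φ a → RelatedQuiver φ a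
  | vertex x hx => source ha ⟨x, hx⟩
  | loopVertex l hl ε hε => loopVertex l hl ε hε

theorem next_target (x : {x // φ x ≠ x}) : next ha (target x) = source ha x := rfl

theorem proj_source (x : {x // φ x ≠ x}) : proj (source ha x) = φ x := by
  rw [source]
  split_ifs <;> rfl

theorem proj_next (v : RelatedQuiver φ a) : proj (next ha v) = φ (proj v) := by
  cases v with
  | vertex x hx => exact proj_source ha _
  | loopVertex l hl ε hε => exact hl.symm

theorem next_eq_iff (v : RelatedQuiver φ a) : next ha v = v ↔ φ (proj v) = proj v := by
  refine ⟨fun h => by rw [← proj_next ha, h], fun h => ?_⟩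
  cases v with
  | vertex x hx => exact absurd h hx
  | loopVertex l hl ε hε => rfl

/-- The projection intertwines `next` with `φ`, and a vertex is fixed exactly when its projection
is. -/
theorem isEventuallyFixed_next_iff : IsEventuallyFixed (next ha) ↔ IsEventuallyFixed φ := by
  have h : ∀ n v, proj ((next ha)^[n] v) = φ^[n] (proj v) := fun n v =>
    (Function.Semiconj.iterate_right (f := proj) (proj_next ha) n).eq v
  constructor
  · intro H x
    by_cases hx : φ x = x
    · exact ⟨0, hx⟩
    · obtain ⟨n, hn⟩ := H (vertex x hx)
      rw [next_eq_iff, h] at hn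
      exact ⟨n, hn⟩
  · intro H v
    obtain ⟨n, hn⟩ := H (proj v)
    exact ⟨n, by rwa [next_eq_iff, h]⟩

include ha in
theorem isUnionOneSinkOneValued_op_iff :
    IsUnionOneSinkOneValued (RelatedQuiver φ a)ᵒᵖ ↔ IsEventuallyFixed φ := by
  rw [← isEventuallyFixed_next_iff ha]
  have h1 : ∀ v w : (RelatedQuiver φ a)ᵒᵖ, (v ⟶ w) → w = .op (next ha v.unop) := by
    intro v w f
    obtain ⟨x, hx, hx'⟩ := (isArrow_iff ha _ _).1 f.unop.down
    rw [← hx', next_target, hx]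
  rw [isUnionOneSinkOneValued_iff (g := fun v => .op (next ha v.unop)) h1]
  · have h : ∀ n v, Opposite.op ((next ha)^[n] v) =
        (fun v : (RelatedQuiver φ a)ᵒᵖ => .op (next ha v.unop))^[n] (.op v) := fun n v =>
      (Function.Semiconj.iterate_right (f := Opposite.op) (fun _ => rfl) n).eq v
    constructor
    · intro H v
      obtain ⟨n, hn⟩ := H (.op v)
      rw [← h] at hn
      exact ⟨n, Opposite.op_injective hn⟩
    · intro H v
      obtain ⟨n, hn⟩ := H v.unop
      refine ⟨n, ?_⟩
      rw [← Opposite.op_unop v, ← h]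
      exact congrArg Opposite.op hn
  · intro v hv w
    refine ⟨fun f => ?_⟩
    obtain ⟨x, hx, hx'⟩ := (isArrow_iff ha _ _).1 f.unop.down
    have := (next_eq_iff ha _).1 (Opposite.op_injective hv)
    rw [← hx'] at this
    exact x.2 this
  · intro v hv
    induction v with
    | op v =>
    cases v with
    | loopVertex l hl ε hε => exact absurd rfl hv
    | vertex x hx =>
      have f : next ha (vertex x hx) ⟶ vertex x hx :=
        ⟨(isArrow_iff ha _ _).2 ⟨⟨x, hx⟩, rfl, rfl⟩⟩
      refine ⟨⟨⟨⟨_, f.op⟩⟩, ?_⟩⟩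
      rintro ⟨w, f'⟩
      obtain rfl := h1 _ _ f'
      exact congrArg (Sigma.mk _) (Opposite.unop_injective (PLift.down_injective rfl))

include ha in
theorem card_total [Finite E] :
    Nat.card (Quiver.Total (RelatedQuiver φ a)) = Nat.card {x // φ x ≠ x} := by
  symm
  refine Nat.card_congr (Equiv.ofBijective (fun x =>
    ⟨source ha x, target x, ⟨(isArrow_iff ha _ _).2 ⟨x, rfl, rfl⟩⟩⟩) ⟨?_, ?_⟩)
  · intro x y h
    exact target_injective (congrArg Quiver.Total.right h)
  · rintro ⟨v, w, ⟨f⟩⟩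
    obtain ⟨x, rfl, rfl⟩ := (isArrow_iff ha _ _).1 f
    exact ⟨x, rfl⟩

/-- The vertices of the related quiver, as non-loop vertices and pairs of a loop vertex and a
sign. -/
noncomputable def equivSum (hk : (1 : k) ≠ 0) :
    RelatedQuiver φ a ≃ {x // φ x ≠ x} ⊕ {l // φ l = l} × Bool where
  toFun
    | vertex x hx => Sum.inl ⟨x, hx⟩
    | loopVertex l hl ε _ => open Classical in Sum.inr (⟨l, hl⟩, decide (ε = 0))
  invFun
    | Sum.inl x => vertex x.1 x.2
    | Sum.inr (l, b) => loopVertex l.1 l.2 (if b then 0 else -1) (by cases b <;> simp)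
  left_inv v := by
    cases v with
    | vertex x hx => rfl
    | loopVertex l hl ε hε => rcases hε with rfl | rfl <;> simp [hk]
  right_inv v := by
    rcases v with x | ⟨l, b⟩
    · rfl
    · cases b <;> simp [hk]

end RelatedQuiver

/-! ### Functions constant on components -/

section LocallyConstant

variable {k E : Type*} [Field k] {φ : E → E} {a : E → k}
  (ha : ∀ x, φ x ≠ x → φ (φ x) = φ x → a x = 0 ∨ a x = -1)

open RelatedQuiver

/-- The functions on the set of connected components of the related quiver. -/
noncomputable def componentsEquiv :
    (Quiver.WeaklyConnectedComponent (RelatedQuiver φ a) → k) ≃ₗ[k]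
      LinearMap.ker (arrowDifference k (source ha) target) := by
  refine LinearEquiv.ofBijective (LinearMap.codRestrict _
    (LinearMap.funLeft k k Quiver.WeaklyConnectedComponent.mk) ?_) ⟨?_, ?_⟩
  · intro F
    rw [LinearMap.mem_ker]
    ext x
    have f : source ha x ⟶ target x := ⟨(isArrow_iff ha _ _).2 ⟨x, rfl, rfl⟩⟩
    have h : Quiver.WeaklyConnectedComponent.mk (source ha x) =
      Quiver.WeaklyConnectedComponent.mk (target x) := component_eq_of_hom f
    simp [LinearMap.funLeft_apply, h]
  · intro F G h
    have h' := congrArg Subtype.val h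
    ext c
    obtain ⟨v, rfl⟩ : ∃ v : RelatedQuiver φ a,
      (v : Quiver.WeaklyConnectedComponent (RelatedQuiver φ a)) = c := Quotient.exists_rep c
    exact congrFun h' v
  · rintro ⟨c, hc⟩
    have harrow : ∀ v w : RelatedQuiver φ a, (v ⟶ w) → c v = c w := by
      intro v w f
      obtain ⟨x, rfl, rfl⟩ := (isArrow_iff ha _ _).1 f.down
      exact (sub_eq_zero.1 (congrFun hc x)).symm
    have hpath : ∀ v w : RelatedQuiver φ a,
        (@Quiver.Path (Quiver.Symmetrify (RelatedQuiver φ a)) _ v w) → c v = c w := by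
      intro v w p
      induction p with
      | nil => rfl
      | cons p f ih =>
        rcases f with f | f
        · exact ih.trans (harrow _ _ f)
        · exact ih.trans (harrow _ _ f).symm
    refine ⟨Quotient.lift c fun v w ⟨p⟩ => hpath v w p, Subtype.ext ?_⟩
    rfl

theorem finrank_ker_eq_numComponents [Finite (RelatedQuiver φ a)] :
    Module.finrank k (LinearMap.ker (arrowDifference k (source ha) target)) =
      numComponents (RelatedQuiver φ a) := by
  have : Finite (Quiver.WeaklyConnectedComponent (RelatedQuiver φ a)) :=
    Finite.of_surjective Quiver.WeaklyConnectedComponent.mk Quotient.exists_rep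
  have := Fintype.ofFinite (Quiver.WeaklyConnectedComponent (RelatedQuiver φ a))
  rw [← (componentsEquiv ha).finrank_eq, Module.finrank_fintype_fun_eq_card, numComponents,
    Nat.card_eq_fintype_card]

end LocallyConstant

/-! ### The forest basis of a non-commutative duplicate -/

namespace TwistedTensorProduct

universe u

theorem eq_zero_of_add_mul_X {k A Λ : Type*} [Field k] [Ring A] [Algebra k A] [Ring Λ]
    [Algebra k Λ] (D : TwistedTensorProduct k A (Bool → k) Λ) {b c : A}
    (h : D.inclA b + D.inclA c * D.X = 0) : b = 0 ∧ c = 0 :=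
  D.eq_of_add_mul_X (by rw [h]; simp)

variable {k E : Type*} {Λ : Type u} [Field k] [Fintype E] [DecidableEq E] [Ring Λ] [Algebra k Λ]
  (D : TwistedTensorProduct k (E → k) (Bool → k) Λ)

theorem delta_apply (b : E → k) (x : E) :
    D.delta b x = (b (D.interlacing.φ x) - b x) * D.interlacing.determiningElement x := by
  have h := congrFun (D.interlacing.determiningElement_spec b) x
  rw [Pi.mul_apply, Pi.sub_apply, setMap_spec D.interlacing.f] at h
  exact h

theorem endo_apply (b : E → k) (x : E) : D.endo b x = b (D.interlacing.φ x) :=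
  setMap_spec D.interlacing.f b x

/-- Evaluating `δ² = δ` at `x` on the indicator of `φ x` gives `-a_x² = a_x`: the value of `δ` at
the fixed point `φ x` is zero and leaves no other term. -/
theorem determiningElement_eq (x : E) (hx : D.interlacing.φ x ≠ x)
    (hx' : D.interlacing.φ (D.interlacing.φ x) = D.interlacing.φ x) :
    D.interlacing.determiningElement x = 0 ∨ D.interlacing.determiningElement x = -1 := by
  have h : D.delta (D.delta _) x = _ :=
    congrFun (D.interlacing.idem (Pi.single (D.interlacing.φ x) 1)) x
  change _ = D.delta _ x at h
  simp only [delta_apply, hx', Pi.single_eq_same, Pi.single_eq_of_ne hx.symm] at h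
  rw [or_iff_not_imp_left]
  intro h0
  apply mul_left_cancel₀ h0
  linear_combination -h

/-- The idempotent of `Λ` given by a point of `E`. -/
noncomputable def point (x : E) : Λ := D.inclA (Pi.single x 1)

theorem point_mul (z : E) (b : E → k) : D.point z * D.inclA b = b z • D.point z := by
  rw [point, ← map_mul, ← map_smul]
  congr 1
  ext x
  by_cases h : x = z
  · subst h
    simp
  · simp [h]

theorem inclA_eq_sum (b : E → k) : D.inclA b = ∑ x, b x • D.point x := by
  simp only [point, ← map_smul, ← map_sum]
  congr 1
  ext x
  simp [Finset.sum_apply, Pi.single_apply]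

theorem sum_point : ∑ x, D.point x = 1 := by
  rw [← map_one D.inclA, inclA_eq_sum]
  simp

theorem point_mul_point (z w : E) : D.point z * D.point w = if z = w then D.point z else 0 := by
  rw [point.eq_1 D w, point_mul]
  split_ifs with h
  · subst h
    simp
  · simp [h]

theorem point_mul_X_mul (z : E) (b : E → k) : D.point z * D.X * D.inclA b =
    ((b (D.interlacing.φ z) - b z) * D.interlacing.determiningElement z) • D.point z +
      b (D.interlacing.φ z) • (D.point z * D.X) := by
  rw [mul_assoc, X_mul, mul_add, ← mul_assoc, point_mul, point_mul, delta_apply, endo_apply,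
    smul_mul_assoc]

/-- The element of `Λ` given by a vertex of the related quiver. -/
noncomputable def vertexElement : D.relatedQuiver → Λ
  | .vertex x _ => D.point x
  | .loopVertex l _ ε _ => open Classical in
    if ε = 0 then D.point l * D.X else D.point l * (1 - D.X)

/-- The element of `Λ` given by the arrow of the related quiver that ends at `x`. -/
noncomputable def arrowElement (x : E) : Λ :=
  D.point x * D.X + D.interlacing.determiningElement x • D.point x

/-- The summand `a_x u_x` in the arrow element is the correction that cancels the unwanted component
`u_x X u_x = -a_x u_x`. -/
theorem arrowElement_eq (x : E) (hx : D.interlacing.φ x ≠ x) :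
    D.arrowElement x * D.point (D.interlacing.φ x) = D.arrowElement x := by
  rw [arrowElement, add_mul, smul_mul_assoc, point_mul_point, if_neg hx.symm,
    point.eq_1 D (D.interlacing.φ x), point_mul_X_mul]
  simp [Pi.single_eq_of_ne hx.symm, add_comm]

/-- Over a fixed point the `δ`-term vanishes. Hence `u_l X` and `u_l (1 - X)` are orthogonal
idempotents that refine `u_l`. -/
theorem point_loop_mul_X_mul {l : E} (hl : D.interlacing.φ l = l) (z : E) :
    D.point l * D.X * D.point z = if l = z then D.point l * D.X else 0 := by
  rw [point.eq_1 D z, point_mul_X_mul, hl]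
  split_ifs with h
  · subst h
    simp
  · simp [h]

theorem vertexElement_mul_point (v : D.relatedQuiver) (z : E) :
    D.vertexElement v * D.point z = if v.proj = z then D.vertexElement v else 0 := by
  cases v with
  | vertex x hx => exact D.point_mul_point x z
  | loopVertex l hl ε hε =>
    simp only [vertexElement, RelatedQuiver.proj]
    split_ifs <;> simp_all [mul_sub, sub_mul, point_loop_mul_X_mul, point_mul_point]

theorem point_mul_vertexElement (v : D.relatedQuiver) :
    D.point v.proj * D.vertexElement v = D.vertexElement v := by
  cases v with
  | vertex x hx => simp [vertexElement, RelatedQuiver.proj, point_mul_point]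
  | loopVertex l hl ε hε =>
    simp only [vertexElement, RelatedQuiver.proj]
    split_ifs <;> rw [← mul_assoc, point_mul_point, if_pos rfl]

theorem vertexElement_loop_zero (l : E) (hl : D.interlacing.φ l = l) (hε) :
    D.vertexElement (.loopVertex l hl 0 hε) = D.point l * D.X := by
  simp [vertexElement]

theorem vertexElement_loop_neg_one (l : E) (hl : D.interlacing.φ l = l) (hε) :
    D.vertexElement (.loopVertex l hl (-1) hε) = D.point l * (1 - D.X) := by
  simp [vertexElement]

noncomputable instance : Fintype D.relatedQuiver :=
  Fintype.ofEquiv _ (RelatedQuiver.equivSum one_ne_zero).symm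

theorem completeOrthogonalIdempotents_vertexElement :
    CompleteOrthogonalIdempotents D.vertexElement := by
  rw [CompleteOrthogonalIdempotents.iff_ortho_complete]
  constructor
  · intro v w hvw
    by_cases h : v.proj = w.proj
    · cases v with
      | vertex x hx =>
        cases w with
        | vertex y hy =>
          obtain rfl : x = y := h
          exact absurd rfl hvw
        | loopVertex l hl ε hε =>
          obtain rfl : x = l := h
          exact absurd hl hx
      | loopVertex l hl ε hε =>
        cases w with
        | vertex y hy =>
          obtain rfl : l = y := h
          exact absurd hl hy
        | loopVertex l' hl' ε' hε' =>
          obtain rfl : l = l' := h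
          have hX : D.point l * D.X * (D.point l * D.X) = D.point l * D.X := by
            rw [← mul_assoc, D.point_loop_mul_X_mul hl, if_pos rfl, mul_assoc, D.X_mul_X]
          have h1 : D.point l * D.X * D.point l = D.point l * D.X := by
            rw [D.point_loop_mul_X_mul hl, if_pos rfl]
          have h2 : D.point l * (D.point l * D.X) = D.point l * D.X := by
            rw [← mul_assoc, point_mul_point, if_pos rfl]
          rcases hε with rfl | rfl <;> rcases hε' with rfl | rfl
          · exact absurd rfl hvw
          · rw [vertexElement_loop_zero, vertexElement_loop_neg_one, mul_sub, mul_one, mul_sub,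
              hX, h1, sub_self]
          · rw [vertexElement_loop_zero, vertexElement_loop_neg_one, mul_sub, mul_one, sub_mul,
              hX, h2, sub_self]
          · exact absurd rfl hvw
    · rw [← D.point_mul_vertexElement w, ← mul_assoc, vertexElement_mul_point, if_neg h, zero_mul]
  -- The two pieces over each fixed point add up to its point idempotent, so the total is the sum of
  -- all points of `E`.
  · rw [← (RelatedQuiver.equivSum (one_ne_zero (α := k))).symm.sum_comp, Fintype.sum_sum_type,
      Fintype.sum_prod_type, ← D.sum_point,
      ← Fintype.sum_subtype_add_sum_subtype (fun x => D.interlacing.φ x = x), add_comm]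
    congr 1
    refine Finset.sum_congr rfl fun l _ => ?_
    rw [Fintype.sum_bool]
    change D.vertexElement (.loopVertex l.1 l.2 0 _) +
      D.vertexElement (.loopVertex l.1 l.2 (-1) _) = _
    rw [vertexElement_loop_zero, vertexElement_loop_neg_one, ← mul_add, add_sub_cancel, mul_one]

theorem vertexElement_ne_zero (v : D.relatedQuiver) : D.vertexElement v ≠ 0 := by
  intro h
  cases v with
  | vertex x hx =>
    have := D.eq_zero_of_add_mul_X (b := Pi.single x 1) (c := 0) (by rw [← h]; simp; rfl)
    simpa using this.1
  | loopVertex l hl ε hε =>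
    rcases hε with rfl | rfl
    · have := D.eq_zero_of_add_mul_X (b := 0) (c := Pi.single l 1)
        (by rw [← h, vertexElement_loop_zero]; simp [point])
      simpa using this.2
    · have := D.eq_zero_of_add_mul_X (b := Pi.single l 1) (c := -Pi.single l 1)
        (by rw [← h, vertexElement_loop_neg_one]; simp [point, mul_add, sub_eq_add_neg])
      simpa using this.1

theorem arrowElement_ne_zero (x : E) : D.arrowElement x ≠ 0 := by
  intro h
  have := D.eq_zero_of_add_mul_X (b := D.interlacing.determiningElement x • Pi.single x 1)
    (c := Pi.single x 1) (by rw [← h, arrowElement, add_comm, map_smul]; rfl)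
  simpa using this.2

theorem span_vertexElement_arrowElement :
    Submodule.span k (Set.range D.vertexElement ∪
      Set.range fun x : {x // D.interlacing.φ x ≠ x} => D.arrowElement x) = ⊤ := by
  set P := Submodule.span k (Set.range D.vertexElement ∪
      Set.range fun x : {x // D.interlacing.φ x ≠ x} => D.arrowElement x)
  have hv : ∀ v, D.vertexElement v ∈ P := fun v => Submodule.subset_span (Or.inl ⟨v, rfl⟩)
  have hα : ∀ x, D.interlacing.φ x ≠ x → D.arrowElement x ∈ P :=
    fun x hx => Submodule.subset_span (Or.inr ⟨⟨x, hx⟩, rfl⟩)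
  have hpt : ∀ x, D.point x ∈ P ∧ D.point x * D.X ∈ P := by
    intro x
    by_cases hx : D.interlacing.φ x = x
    · have h0 := hv (.loopVertex x hx 0 (Or.inl rfl))
      have h1 := hv (.loopVertex x hx (-1) (Or.inr rfl))
      rw [vertexElement_loop_zero] at h0
      rw [vertexElement_loop_neg_one] at h1
      refine ⟨?_, h0⟩
      have := P.add_mem h0 h1
      rwa [← mul_add, add_sub_cancel, mul_one] at this
    · have h0 : D.point x ∈ P := hv (.vertex x hx)
      have := P.sub_mem (hα x hx) (P.smul_mem (D.interlacing.determiningElement x) h0)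
      rw [arrowElement, add_sub_cancel_right] at this
      exact ⟨h0, this⟩
  rw [eq_top_iff]
  rintro z -
  obtain ⟨m, rfl⟩ := D.equiv.surjective z
  rw [equiv_apply, inclA_eq_sum, inclA_eq_sum, Finset.sum_mul]
  refine P.add_mem (P.sum_mem fun x _ => P.smul_mem _ (hpt x).1) (P.sum_mem fun x _ => ?_)
  rw [smul_mul_assoc]
  exact P.smul_mem _ (hpt x).2

/-- Right multiplication by `X` gives `β_x X = (1 + a_x) u_x X`. Over a fixed point this is `β_x`
when `a_x = 0` and zero when `a_x = -1`, which selects the piece `l_ε` with `ε = a_x`. -/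
theorem arrowElement_mul_source (x : {x // D.interlacing.φ x ≠ x}) :
    D.arrowElement x * D.vertexElement (RelatedQuiver.source D.determiningElement_eq x) =
      D.arrowElement x := by
  have h1 : D.arrowElement x * D.X =
      (1 + D.interlacing.determiningElement x) • (D.point x * D.X) := by
    rw [arrowElement, add_mul, smul_mul_assoc, mul_assoc, D.X_mul_X, add_smul, one_smul]
  rw [RelatedQuiver.source]
  split_ifs with h
  · simp only [vertexElement]
    split_ifs with h0
    · rw [← mul_assoc, D.arrowElement_eq x x.2, h1, h0, arrowElement, h0]
      simp
    · have h0' := (D.determiningElement_eq x x.2 h).resolve_left h0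
      rw [← mul_assoc, D.arrowElement_eq x x.2, mul_sub, h1, h0']
      simp
  · exact D.arrowElement_eq x x.2

theorem exists_isForestBasis (h : IsEventuallyFixed D.interlacing.φ) :
    ∃ depth, IsForestBasis k D.vertexElement
      (fun x : {x // D.interlacing.φ x ≠ x} => D.arrowElement x)
      (RelatedQuiver.source D.determiningElement_eq) RelatedQuiver.target depth := by
  obtain ⟨depth, hd⟩ :=
    ((RelatedQuiver.isEventuallyFixed_next_iff D.determiningElement_eq).2 h).exists_depth
  refine ⟨depth, D.completeOrthogonalIdempotents_vertexElement, D.arrowElement_mul_source, ?_,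
    D.vertexElement_ne_zero, fun x => D.arrowElement_ne_zero x, D.span_vertexElement_arrowElement,
    RelatedQuiver.target_injective, fun x => hd (RelatedQuiver.target x) fun h => ?_⟩
  · intro x
    change D.point x * D.arrowElement x = _
    rw [arrowElement, mul_add, mul_smul_comm, ← mul_assoc, point_mul_point, if_pos rfl]
  · rw [RelatedQuiver.next_eq_iff] at h
    exact x.2 h

end TwistedTensorProduct

theorem mainTheorem7 {k E Λ : Type*} [Field k] [Fintype E] [DecidableEq E] [Ring Λ] [Algebra k Λ]
    (D : TwistedTensorProduct k (E → k) (Bool → k) Λ) :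
    (IsUnionOneSinkOneValued (D.relatedQuiver)ᵒᵖ ↔ HasOnlyLoopCycles D.mapQuiver) ∧
    (IsUnionOneSinkOneValued (D.relatedQuiver)ᵒᵖ →
      (∀ n : ℕ, 2 ≤ n → Subsingleton (HochschildCohomology k Λ n)) ∧
      (Module.Finite k (HochschildCohomology k Λ 0) ∧
        Module.finrank k (HochschildCohomology k Λ 0) = numComponents D.relatedQuiver) ∧
      (Module.Finite k (HochschildCohomology k Λ 1) ∧
        (Module.finrank k (HochschildCohomology k Λ 1) : ℤ) =
          graphEulerCharacteristic D.relatedQuiver)) := by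
  rw [RelatedQuiver.isUnionOneSinkOneValued_op_iff D.determiningElement_eq]
  refine ⟨hasOnlyLoopCycles_mapQuiver_iff.symm, fun h => ?_⟩
  obtain ⟨depth, H⟩ := D.exists_isForestBasis h
  have hcomp := finrank_ker_eq_numComponents D.determiningElement_eq
  have hcard := finrank_ker_arrowDifference (k := k) H.target_injective H.depth_target
  have := H.subsingleton_one
  refine ⟨fun n hn => H.subsingleton_of_two_le hn,
    ⟨Module.Finite.equiv H.cohomologyZeroEquiv.symm, ?_⟩, inferInstance, ?_⟩
  · rw [H.cohomologyZeroEquiv.finrank_eq, hcomp]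
  -- Both sides are zero: degree one vanishes, and the related quiver is a forest.
  · rw [Module.finrank_zero_of_subsingleton, graphEulerCharacteristic,
      RelatedQuiver.card_total D.determiningElement_eq, ← hcomp, Nat.card_eq_fintype_card,
      Nat.card_eq_fintype_card, ← hcard]
    push_cast
    ring
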